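/- **Theorem (modified Arzelà–Ascoli theorem; a theorem of ZF, no form of the axiom of choice is used).** Let $(X,d_X)$ be a metric space that is compact (every open cover has a finite subcover) and separable (it has a countable dense subset), let $(Y,d_Y)$ be a metric space, let $\mathcal C(X,Y)$ be the set of bounded continuous functions $X\to Y$ with the metric $d(f,g)=\sup_{x\in X}d_Y(f(x),g(x))$, and let $\mathcal F\subseteq\mathcal C(X,Y)$. (The case $Y=\mathbb R$ is $\mathcal F \subseteq \mathcal C(X)$.) Then ZF proves that the following two statements are equivalent: 1. Every sequence in $\mathcal F$ has a subsequence that converges in $\mathcal C(X,Y)$. 2. Every countable subset $\mathcal G\subseteq\mathcal F$ is pointwise relatively sequentially compact (for every $x\in X$, every sequence in $\{f(x)\mid f\in\mathcal G\}$ has a subsequence that converges in $Y$) and equicontinuous (for all $x\in X$ and $\varepsilon>0$ there is a $\delta>0$ such that $d_Y(f(x),f(x'))<\varepsilon$ for all $f\in\mathcal G$ and all $x'\in X$ with $d_X(x,x')<\delta$). Here "ZF proves" is expressed as: in every model $M$ of the first-order Zermelo–Fraenkel axioms (without choice) the assertion holds, all notions (natural numbers, real numbers as Dedekind cuts, metric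 spaces, functions, sequences, countable and finite sets) being interpreted inside $M$; by Gödel's completeness theorem the two are the same. -/

import Mathlib

/-!
ZF set theory is treated through its first-order models: a theorem of ZF is a first-order
statement that holds in every model of the ZF axioms (Gödel's completeness theorem).
All notions below the axioms are first-order formulas in the membership relation of a
structure `M`: their quantifiers range over `M` only.  Natural numbers, rational numbers, real
numbers, metric spaces, sequences and so on are those of the model `M`.
-/

namespace SetModel

universe u

/-! ### The language of set theory and the axioms of ZF -/

/-- The only non-logical symbol of set theory: the binary relation symbol for membership. -/
inductive MemSymbol : ℕ → Type
  | mem : MemSymbol 2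

/-- The first-order language of set theory. -/
def setLang : FirstOrder.Language.{0, 0} := ⟨fun _ => Empty, MemSymbol⟩

/-- The membership relation of a structure for the language of set theory. -/
def Mem {M : Type u} [setLang.Structure M] (x y : M) : Prop :=
  FirstOrder.Language.Structure.RelMap (L := setLang) MemSymbol.mem ![x, y]

infix:50 " ∈ᴹ " => Mem

/-- `a ⊆ b`. -/
def Sub {M : Type u} [setLang.Structure M] (a b : M) : Prop := ∀ x, x ∈ᴹ a → x ∈ᴹ b

/-- `e = ∅`. -/
def IsEmptySet {M : Type u} [setLang.Structure M] (e : M) : Prop := ∀ x, ¬ x ∈ᴹ e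

/-- `s = n ∪ {n}`. -/
def IsSucc {M : Type u} [setLang.Structure M] (s n : M) : Prop := ∀ x, x ∈ᴹ s ↔ x ∈ᴹ n ∨ x = n

/-- `w` contains `∅` and is closed under `n ↦ n ∪ {n}`. -/
def IsInductive {M : Type u} [setLang.Structure M] (w : M) : Prop :=
  (∃ e, e ∈ᴹ w ∧ IsEmptySet e) ∧ ∀ n, n ∈ᴹ w → ∃ s, s ∈ᴹ w ∧ IsSucc s n

/-- `M` is a model of the Zermelo--Fraenkel axioms (without choice).  The two schemas range over
the classes and the class relations that are first-order definable with parameters from `M`. -/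
structure IsModelZF (M : Type u) [setLang.Structure M] : Prop where
  extensionality : ∀ a b : M, (∀ x, x ∈ᴹ a ↔ x ∈ᴹ b) → a = b
  pairing : ∀ a b : M, ∃ c, ∀ x, x ∈ᴹ c ↔ x = a ∨ x = b
  union : ∀ a : M, ∃ c, ∀ x, x ∈ᴹ c ↔ ∃ y, y ∈ᴹ a ∧ x ∈ᴹ y
  powerset : ∀ a : M, ∃ c, ∀ x, x ∈ᴹ c ↔ Sub x a
  infinity : ∃ w : M, IsInductive w
  foundation : ∀ a : M, (∃ x, x ∈ᴹ a) → ∃ x, x ∈ᴹ a ∧ ∀ y, y ∈ᴹ x → ¬ y ∈ᴹ a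
  separation : ∀ P : M → Prop, (Set.univ : Set M).Definable₁ setLang {x | P x} →
    ∀ a : M, ∃ c, ∀ x, x ∈ᴹ c ↔ x ∈ᴹ a ∧ P x
  replacement : ∀ R : M → M → Prop,
    (Set.univ : Set M).Definable₂ setLang {p : M × M | R p.1 p.2} →
    ∀ a : M, (∀ x, x ∈ᴹ a → ∀ y y', R x y → R x y' → y = y') →
      ∃ c, ∀ y, y ∈ᴹ c ↔ ∃ x, x ∈ᴹ a ∧ R x y

/-! ### Pairs and functions -/

/-- `s = {a, b}`. -/
def IsUPair {M : Type u} [setLang.Structure M] (s a b : M) : Prop := ∀ x, x ∈ᴹ s ↔ x = a ∨ x = b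

/-- `p = (a, b)`, the Kuratowski pair `{{a}, {a, b}}`. -/
def IsPair {M : Type u} [setLang.Structure M] (p a b : M) : Prop :=
  ∀ z, z ∈ᴹ p ↔ IsUPair z a a ∨ IsUPair z a b

/-- `(a, b) ∈ f`, that is, `f(a) = b` when `f` is a function. -/
def App {M : Type u} [setLang.Structure M] (f a b : M) : Prop := ∃ p, IsPair p a b ∧ p ∈ᴹ f

/-- `f` is a function with domain the class `A` and values in the class `B`. -/
def IsMap {M : Type u} [setLang.Structure M] (A B : M → Prop) (f : M) : Prop :=
  (∀ e, e ∈ᴹ f → ∃ a b, A a ∧ B b ∧ IsPair e a b) ∧ ∀ a, A a → ∃! b, App f a b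

/-- Injectivity of a function. -/
def IsInj {M : Type u} [setLang.Structure M] (f : M) : Prop :=
  ∀ a a' b, App f a b → App f a' b → a = a'

/-! ### Natural numbers -/

/-- `n` is a natural number (a finite von Neumann ordinal), that is, `n ∈ ω`. -/
def IsNat {M : Type u} [setLang.Structure M] (n : M) : Prop := ∀ w, IsInductive w → n ∈ᴹ w

/-- `m ≤ n` for natural numbers. -/
def NatLe {M : Type u} [setLang.Structure M] (m n : M) : Prop := m ∈ᴹ n ∨ m = n

/-- `m + n = k` for natural numbers: `k` is the value at `n` of the function `f` on `{0, …, n}`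
with `f(0) = m` and `f(i + 1) = f(i) + 1`. -/
def NatAdd {M : Type u} [setLang.Structure M] (m n k : M) : Prop :=
  IsNat m ∧ IsNat n ∧ ∃ f, IsMap (fun i => NatLe i n) IsNat f ∧
    (∀ o, IsEmptySet o → App f o m) ∧
    (∀ i j v w, i ∈ᴹ n → IsSucc j i → App f i v → IsSucc w v → App f j w) ∧
    App f n k

/-- `m * n = k` for natural numbers: `k` is the value at `n` of the function `f` on `{0, …, n}`
with `f(0) = 0` and `f(i + 1) = f(i) + m`. -/
def NatMul {M : Type u} [setLang.Structure M] (m n k : M) : Prop :=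
  IsNat m ∧ IsNat n ∧ ∃ f, IsMap (fun i => NatLe i n) IsNat f ∧
    (∀ o, IsEmptySet o → App f o o) ∧
    (∀ i j v w, i ∈ᴹ n → IsSucc j i → App f i v → NatAdd v m w → App f j w) ∧
    App f n k

/-- `m * n + m' * n' = k` for natural numbers. -/
def NatMulAddMul {M : Type u} [setLang.Structure M] (m n m' n' k : M) : Prop :=
  ∃ s t, NatMul m n s ∧ NatMul m' n' t ∧ NatAdd s t k

/-- `S` is finite: it is in bijection with a natural number. -/
def IsFiniteSet {M : Type u} [setLang.Structure M] (S : M) : Prop :=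
  ∃ n f, IsNat n ∧ IsMap (fun i => i ∈ᴹ n) (fun x => x ∈ᴹ S) f ∧ IsInj f ∧
    ∀ x, x ∈ᴹ S → ∃ i, App f i x

/-- `S` is countable (finite or countably infinite): it injects into `ω`. -/
def IsCountableSet {M : Type u} [setLang.Structure M] (S : M) : Prop :=
  ∃ f, IsMap (fun x => x ∈ᴹ S) IsNat f ∧ IsInj f

/-! ### Rational numbers, as formal fractions -/

/-- `q` is the triple `((a, b), c)` of natural numbers with `c ≠ 0`; it represents the rational
number `(a - b) / c`. -/
def IsFrac {M : Type u} [setLang.Structure M] (q a b c : M) : Prop :=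
  IsNat a ∧ IsNat b ∧ IsNat c ∧ ¬ IsEmptySet c ∧ ∃ p, IsPair p a b ∧ IsPair q p c

/-- `q` represents a rational number. -/
def IsRat {M : Type u} [setLang.Structure M] (q : M) : Prop := ∃ a b c, IsFrac q a b c

/-- The order of the represented rational numbers:
`(a - b) / c ≤ (a' - b') / c'` means `a * c' + b' * c ≤ a' * c + b * c'`. -/
def RatLe {M : Type u} [setLang.Structure M] (q q' : M) : Prop :=
  ∃ a b c a' b' c' s t, IsFrac q a b c ∧ IsFrac q' a' b' c' ∧
    NatMulAddMul a c' b' c s ∧ NatMulAddMul a' c b c' t ∧ NatLe s t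

/-- The strict order of the represented rational numbers. -/
def RatLt {M : Type u} [setLang.Structure M] (q q' : M) : Prop :=
  IsRat q ∧ IsRat q' ∧ ¬ RatLe q' q

/-- Addition of formal fractions:
`(a - b) / c + (a' - b') / c' = ((a * c' + a' * c) - (b * c' + b' * c)) / (c * c')`. -/
def RatAdd {M : Type u} [setLang.Structure M] (q q' t : M) : Prop :=
  ∃ a b c a' b' c' a'' b'' c'', IsFrac q a b c ∧ IsFrac q' a' b' c' ∧ IsFrac t a'' b'' c'' ∧
    NatMulAddMul a c' a' c a'' ∧ NatMulAddMul b c' b' c b'' ∧ NatMul c c' c''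

/-! ### Real numbers, as Dedekind cuts -/

/-- `r` is a real number: a nonempty proper initial segment, without a greatest element, of the
rational numbers. (An initial segment of the formal fractions contains with a fraction every other
fraction that represents the same rational number, so no quotient has to be taken.) -/
def IsReal {M : Type u} [setLang.Structure M] (r : M) : Prop :=
  (∀ q, q ∈ᴹ r → IsRat q) ∧ (∃ q, q ∈ᴹ r) ∧ (∃ q, IsRat q ∧ ¬ q ∈ᴹ r) ∧
    (∀ q p, q ∈ᴹ r → RatLe p q → p ∈ᴹ r) ∧ ∀ q, q ∈ᴹ r → ∃ p, p ∈ᴹ r ∧ RatLt q p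

/-- `r ≤ s` for real numbers. -/
def RealLe {M : Type u} [setLang.Structure M] (r s : M) : Prop := Sub r s

/-- `r < s` for real numbers. -/
def RealLt {M : Type u} [setLang.Structure M] (r s : M) : Prop := Sub r s ∧ r ≠ s

/-- `z` is the real number `0`: the set of all negative rational numbers. -/
def IsZero {M : Type u} [setLang.Structure M] (z : M) : Prop :=
  ∀ q, q ∈ᴹ z ↔ ∃ a b c, IsFrac q a b c ∧ a ∈ᴹ b

/-- `r + s = t` for real numbers. -/
def RealAdd {M : Type u} [setLang.Structure M] (r s t : M) : Prop :=
  ∀ q, q ∈ᴹ t ↔ ∃ p p' v, p ∈ᴹ r ∧ p' ∈ᴹ s ∧ RatAdd p p' v ∧ RatLe q v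

/-- `r` is a real number and `0 ≤ r`. -/
def IsNonneg {M : Type u} [setLang.Structure M] (r : M) : Prop :=
  IsReal r ∧ ∃ z, IsZero z ∧ RealLe z r

/-- `r` is a real number and `0 < r`. -/
def IsPos {M : Type u} [setLang.Structure M] (r : M) : Prop :=
  IsReal r ∧ ∃ z, IsZero z ∧ RealLt z r

/-! ### Metric spaces -/

/-- `d(x, y) = r`. -/
def Dist {M : Type u} [setLang.Structure M] (d x y r : M) : Prop := ∃ p, IsPair p x y ∧ App d p r

/-- `d(x, y) < r`. -/
def DistLt {M : Type u} [setLang.Structure M] (d x y r : M) : Prop :=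
  ∃ s, Dist d x y s ∧ RealLt s r

/-- `d : X × X → ℝ` is a metric on `X`. -/
def IsMetric {M : Type u} [setLang.Structure M] (X d : M) : Prop :=
  IsMap (fun p => ∃ x y, x ∈ᴹ X ∧ y ∈ᴹ X ∧ IsPair p x y) IsReal d ∧
  (∀ x y r, Dist d x y r → IsNonneg r) ∧
  (∀ x y r, Dist d x y r → (IsZero r ↔ x = y)) ∧
  (∀ x y r, Dist d x y r → Dist d y x r) ∧
  (∀ x y z r s t v, Dist d x y r → Dist d y z s → Dist d x z t → RealAdd r s v → RealLe t v)

/-- `U` is an open subset of the metric space `(X, d)`. -/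
def IsOpenIn {M : Type u} [setLang.Structure M] (X d U : M) : Prop :=
  Sub U X ∧ ∀ x, x ∈ᴹ U → ∃ r, IsPos r ∧ ∀ y, y ∈ᴹ X → DistLt d x y r → y ∈ᴹ U

/-- Every open cover of `(X, d)` has a finite subcover. -/
def IsCompactSpace {M : Type u} [setLang.Structure M] (X d : M) : Prop :=
  ∀ C, (∀ U, U ∈ᴹ C → IsOpenIn X d U) → (∀ x, x ∈ᴹ X → ∃ U, U ∈ᴹ C ∧ x ∈ᴹ U) →
    ∃ C', Sub C' C ∧ IsFiniteSet C' ∧ ∀ x, x ∈ᴹ X → ∃ U, U ∈ᴹ C' ∧ x ∈ᴹ U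

/-- `(X, d)` has a countable dense subset. -/
def IsSeparableSpace {M : Type u} [setLang.Structure M] (X d : M) : Prop :=
  ∃ D, Sub D X ∧ IsCountableSet D ∧
    ∀ x r, x ∈ᴹ X → IsPos r → ∃ y, y ∈ᴹ D ∧ DistLt d x y r

/-! ### Spaces of continuous functions -/

/-- `f ∈ C(X, Y)`: `f` is a continuous bounded function from `(X, dX)` to `(Y, dY)`. -/
def IsContBdd {M : Type u} [setLang.Structure M] (X dX Y dY f : M) : Prop :=
  IsMap (fun x => x ∈ᴹ X) (fun y => y ∈ᴹ Y) f ∧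
  (∀ x ε, x ∈ᴹ X → IsPos ε → ∃ δ, IsPos δ ∧ ∀ x', x' ∈ᴹ X → DistLt dX x x' δ →
    ∀ y y', App f x y → App f x' y' → DistLt dY y y' ε) ∧
  (∃ K, IsReal K ∧ ∀ x x' y y' r, App f x y → App f x' y' → Dist dY y y' r → RealLe r K)

/-- `r` is a nonnegative upper bound of the numbers `dY(f(x), g(x))` with `x ∈ X`. -/
def IsUnifBound {M : Type u} [setLang.Structure M] (X dY f g r : M) : Prop :=
  IsNonneg r ∧ ∀ x y y' s, x ∈ᴹ X → App f x y → App g x y' → Dist dY y y' s → RealLe s r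

/-- `r = sup_{x ∈ X} dY(f(x), g(x))`, the supremum being taken in `[0, ∞)` (so that it is `0` for
empty `X`). -/
def SupDist {M : Type u} [setLang.Structure M] (X dY f g r : M) : Prop :=
  IsUnifBound X dY f g r ∧ ∀ r', IsUnifBound X dY f g r' → RealLe r r'

/-! ### Sequences, relative sequential compactness, equicontinuity -/

/-- The sequence `n ↦ a_n`, given by the relation `s n a ↔ a = a_n`, converges to `l` for the
distance given by the relation `dist a b r ↔ r = dist(a, b)`. -/
def ConvergesTo {M : Type u} [setLang.Structure M] (dist : M → M → M → Prop) (s : M → M → Prop)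
    (l : M) : Prop :=
  ∀ ε, IsPos ε → ∃ N, IsNat N ∧ ∀ n a, IsNat n → NatLe N n → s n a →
    ∃ r, dist a l r ∧ RealLt r ε

/-- Every sequence `s` in the class `A` has a subsequence `n ↦ s(k(n))`, `k : ω → ω` strictly
increasing, that converges to a point of `B` for the given distance. -/
def SeqsHaveConvSubseq {M : Type u} [setLang.Structure M] (A B : M → Prop)
    (dist : M → M → M → Prop) : Prop :=
  ∀ s, IsMap IsNat A s → ∃ k, IsMap IsNat IsNat k ∧
    (∀ i j v w, i ∈ᴹ j → App k i v → App k j w → v ∈ᴹ w) ∧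
    ∃ l, B l ∧ ConvergesTo dist (fun n a => ∃ i, App k n i ∧ App s i a) l

/-- `G` is pointwise relatively sequentially compact: for every `x ∈ X`, every sequence in
`{f(x) | f ∈ G}` has a subsequence that converges in `Y`. -/
def PtwiseRelSeqCompact {M : Type u} [setLang.Structure M] (X Y dY G : M) : Prop :=
  ∀ x, x ∈ᴹ X →
    SeqsHaveConvSubseq (fun y => ∃ f, f ∈ᴹ G ∧ App f x y) (fun y => y ∈ᴹ Y) (Dist dY)

/-- `G` is equicontinuous (at every point of `X`). -/
def IsEquicontinuous {M : Type u} [setLang.Structure M] (X dX dY G : M) : Prop :=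
  ∀ x ε, x ∈ᴹ X → IsPos ε → ∃ δ, IsPos δ ∧ ∀ f x', f ∈ᴹ G → x' ∈ᴹ X → DistLt dX x x' δ →
    ∀ y y', App f x y → App f x' y' → DistLt dY y y' ε

end SetModel

/-! Reasoning about `M` from outside may use classical logic and even choice, as long as every set,
sequence or function that has to be an element of `M` is definable with parameters. `Dfn` and `DFun`
record this for types such as `N M`, `R M` and `El X`, whose elements are coded in `M`. Instance
search builds the defining formulas, separation (`mem_sep`) and replacement (`exists_map`) turn
definable data into elements of `M`, and `natRec` gives definable recursion. The theorem then
becomes one about definable maps on `N M` (`seqsHaveConvSubseq_iff`,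
`seqsHaveConvSubseq_iff_uniform`), where choice is replaced by taking the element of least index
(`exists_choice_of_inj`).

From convergent subsequences to countable subsets: if `G` is countable, a sequence of values at `x`
lifts to a sequence of functions by always taking the function of least index, and uniform
convergence gives convergence at `x`. If equicontinuity fails at `x`, the functions of least index
that violate it within distance `1 / (n + 1)` form a sequence. A uniformly convergent subsequence
contradicts the continuity of its limit. The violating points are never selected, since a single one
is enough at the end.

From countable subsets to sequences: the range of a sequence is countable, hence the sequence is
equicontinuous and pointwise compact. Compactness gives a finite cover by open sets on which all
terms oscillate little (`exists_finite_cover`). Thinning out the indices once for each member of the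
cover leaves an unbounded set of indices whose terms are uniformly close (`exists_unb_of_compact`).
Iterating this would require choosing a set of indices at every stage. Instead,
`exists_cauchy_subseq` picks the least index `m` for which unboundedly many later indices have terms
close to the `m`-th one, and this `m` determines the next set. The resulting uniformly Cauchy
subsequence has a limit at each point by pointwise compactness, so completeness of `Y` is not
needed. The limit is definable because it is unique (`exists_uniform_limit`). -/

namespace SetModel

set_option synthInstance.maxSize 10000
set_option synthInstance.maxHeartbeats 200000

universe u

/-! ### Definable relations of a structure -/

section Raw

variable {M : Type u} [setLang.Structure M]

/-- The relation `φ` on `M` is first-order definable with parameters. -/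
def Raw (n : ℕ) (φ : (Fin n → M) → Prop) : Prop :=
  (Set.univ : Set M).Definable setLang {v | φ v}

variable {n m : ℕ} {φ ψ : (Fin n → M) → Prop}

theorem Raw.congr (h : Raw n φ) (e : ∀ v, ψ v ↔ φ v) : Raw n ψ := by
  rwa [show ψ = φ from funext fun v => propext (e v)]

theorem Raw.and (hφ : Raw n φ) (hψ : Raw n ψ) : Raw n fun v => φ v ∧ ψ v :=
  Set.Definable.inter hφ hψ

theorem Raw.not (hφ : Raw n φ) : Raw n fun v => ¬ φ v := Set.Definable.compl hφ

theorem Raw.or (hφ : Raw n φ) (hψ : Raw n ψ) : Raw n fun v => φ v ∨ ψ v :=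
  Set.Definable.union hφ hψ

theorem Raw.imp (hφ : Raw n φ) (hψ : Raw n ψ) : Raw n fun v => φ v → ψ v :=
  (hφ.not.or hψ).congr fun _ => imp_iff_not_or

theorem Raw.iff (hφ : Raw n φ) (hψ : Raw n ψ) : Raw n fun v => φ v ↔ ψ v :=
  ((hφ.imp hψ).and (hψ.imp hφ)).congr fun _ => iff_iff_implies_and_implies

theorem Raw.sub {φ : (Fin m → M) → Prop} (f : Fin m → Fin n) (hφ : Raw m φ) :
    Raw n fun v => φ (v ∘ f) :=
  Set.Definable.preimage_comp f hφ

theorem Raw.ex {φ : (Fin n → M) → M → Prop}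
    (hφ : Raw (n + 1) fun v => φ (fun i => v i.succ) (v 0)) : Raw n fun v => ∃ x, φ v x := by
  have h := Set.Definable.image_comp hφ (Fin.succ : Fin n → Fin (n + 1))
  refine Eq.mp (congrArg _ ?_) h
  ext v
  constructor
  · rintro ⟨w, hw, rfl⟩
    exact ⟨w 0, hw⟩
  · rintro ⟨x, hx⟩
    exact ⟨Fin.cons x v, by simpa using hx, by ext i; simp⟩

theorem Raw.all {φ : (Fin n → M) → M → Prop}
    (hφ : Raw (n + 1) fun v => φ (fun i => v i.succ) (v 0)) : Raw n fun v => ∀ x, φ v x :=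
  (Raw.not (Raw.ex (φ := fun v x => ¬ φ v x) hφ.not)).congr fun v => by simp

theorem Raw.eq (i j : Fin n) : Raw n fun v : Fin n → M => v i = v j :=
  ⟨(FirstOrder.Language.Term.var i).equal (FirstOrder.Language.Term.var j), by ext; simp⟩

theorem Raw.eq_const (i : Fin n) (c : M) : Raw n fun v : Fin n → M => v i = c :=
  ⟨(FirstOrder.Language.Term.var i).equal
    (FirstOrder.Language.Constants.term (setLang.con (⟨c, trivial⟩ : (Set.univ : Set M)))),
    by ext; simp⟩

theorem Raw.mem (i j : Fin n) : Raw n fun v : Fin n → M => v i ∈ᴹ v j := by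
  refine Set.Definable.mono (A := ∅) ?_ (Set.empty_subset _)
  refine Set.empty_definable_iff.2 ⟨FirstOrder.Language.Relations.formula (L := setLang)
    MemSymbol.mem ![FirstOrder.Language.Term.var i, FirstOrder.Language.Term.var j], ?_⟩
  ext v
  simp only [Set.mem_ofPred_eq, Mem]
  refine iff_of_eq (congrArg _ ?_)
  ext k
  fin_cases k <;> rfl

theorem Raw.isUPair (i j k : Fin n) : Raw n fun v : Fin n → M => IsUPair (v i) (v j) (v k) :=
  Raw.all ((Raw.mem 0 i.succ).iff ((Raw.eq 0 j.succ).or (Raw.eq 0 k.succ)))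

theorem Raw.isPair (i j k : Fin n) : Raw n fun v : Fin n → M => IsPair (v i) (v j) (v k) :=
  Raw.all ((Raw.mem 0 i.succ).iff
    ((Raw.isUPair 0 j.succ j.succ).or (Raw.isUPair 0 j.succ k.succ)))

/-- A unary relation of `M` that is definable with parameters. -/
def Raw₁ (S : M → Prop) : Prop := Raw 1 fun v => S (v 0)

/-- A binary relation of `M` that is definable with parameters. -/
def Raw₂ (S : M → M → Prop) : Prop := Raw 2 fun v => S (v 0) (v 1)

theorem Raw₁.app {S : M → Prop} (h : Raw₁ S) (i : Fin n) : Raw n fun v => S (v i) :=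
  Raw.sub ![i] h

theorem Raw₂.app {S : M → M → Prop} (h : Raw₂ S) (i j : Fin n) : Raw n fun v => S (v i) (v j) :=
  Raw.sub ![i, j] h

end Raw

/-! ### Kuratowski pairs. -/

section Pairs

variable {M : Type u} [setLang.Structure M] [hM : Fact (IsModelZF M)]

theorem ext {a b : M} (h : ∀ x, x ∈ᴹ a ↔ x ∈ᴹ b) : a = b := hM.out.extensionality a b h

theorem exists_upair (a b : M) : ∃ c, IsUPair c a b := hM.out.pairing a b

theorem IsUPair.unique {a b c d : M} (h : IsUPair c a b) (h' : IsUPair d a b) : c = d :=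
  ext fun x => (h x).trans (h' x).symm

theorem exists_pair (a b : M) : ∃ c, IsPair c a b := by
  obtain ⟨s, hs⟩ := exists_upair a a
  obtain ⟨t, ht⟩ := exists_upair a b
  obtain ⟨c, hc⟩ := exists_upair s t
  refine ⟨c, fun z => (hc z).trans (or_congr ?_ ?_)⟩
  · exact ⟨fun h => h ▸ hs, fun h => h.unique hs⟩
  · exact ⟨fun h => h ▸ ht, fun h => h.unique ht⟩

/-- The ordered pair. -/
noncomputable def pr (a b : M) : M := (exists_pair a b).choose

theorem isPair_pr (a b : M) : IsPair (pr a b) a b := (exists_pair a b).choose_spec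

theorem IsPair.unique {a b c d : M} (h : IsPair c a b) (h' : IsPair d a b) : c = d :=
  ext fun x => (h x).trans (h' x).symm

theorem isPair_iff {a b c : M} : IsPair c a b ↔ c = pr a b :=
  ⟨fun h => h.unique (isPair_pr a b), fun h => h ▸ isPair_pr a b⟩

theorem IsPair.inj {a b a' b' c : M} (h : IsPair c a b) (h' : IsPair c a' b') :
    a = a' ∧ b = b' := by
  obtain ⟨s, hs⟩ := exists_upair a a
  obtain ⟨t, ht⟩ := exists_upair a b
  obtain ⟨s', hs'⟩ := exists_upair a' a'
  obtain ⟨t', ht'⟩ := exists_upair a' b'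
  -- `{a}` is `{a'}` or `{a', b'}`, and both contain `a'`.
  have e : a = a' := by
    rcases (h' s).1 ((h s).2 (.inl hs)) with k | k
    · exact (((k a').2 (.inl rfl) |> (hs a').1).elim id id).symm
    · exact (((k a').2 (.inl rfl) |> (hs a').1).elim id id).symm
  subst e
  refine ⟨rfl, ?_⟩
  have h1 : ∀ x, x = a ∨ x = b ↔ x = a ∨ x = b' := by
    intro x
    rw [← ht x, ← ht' x]
    rcases (h' t).1 ((h t).2 (.inr ht)) with k | k
    · rcases (h t').1 ((h' t').2 (.inr ht')) with l | l
      · rw [k.unique l]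
      · rw [ht.unique l]
    · rw [k.unique ht']
  have h2 := h1 b
  have h3 := h1 b'
  aesop

theorem pr_inj {a b a' b' : M} : pr a b = pr a' b' ↔ a = a' ∧ b = b' :=
  ⟨fun h => (isPair_pr a b).inj (h ▸ isPair_pr a' b'), by rintro ⟨rfl, rfl⟩; rfl⟩

end Pairs

/-! ### Types represented in `M`, definable predicates and definable functions -/

section DSp

/-- A type whose elements are represented injectively by the elements of a definable class. -/
class DSp (M : outParam (Type u)) [setLang.Structure M] [Fact (IsModelZF M)] (Γ : Type u) where
  enc : Γ → M
  inj : Function.Injective enc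
  rng : Raw₁ fun x => ∃ γ, enc γ = x

open DSp

variable {M : Type u} [setLang.Structure M] [Fact (IsModelZF M)]
variable {Γ Δ E : Type u} [DSp M Γ] [DSp M Δ] [DSp M E]

/-- A definable predicate. -/
class Dfn {Γ : Type u} [DSp M Γ] (φ : Γ → Prop) : Prop where
  raw : Raw₁ fun x => ∃ γ, enc γ = x ∧ φ γ

/-- A definable function. -/
class DFun {Γ Δ : Type u} [DSp M Γ] [DSp M Δ] (f : Γ → Δ) : Prop where
  raw : Raw₂ fun x y => ∃ γ, enc γ = x ∧ enc (f γ) = y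

theorem Dfn.congr {φ ψ : Γ → Prop} (h : Dfn φ) (e : ∀ v, ψ v ↔ φ v) : Dfn ψ := by
  rwa [show ψ = φ from funext fun v => propext (e v)]

instance instDSpSelf : DSp M M where
  enc := id
  inj := Function.injective_id
  rng := (Raw.eq 0 0).congr (by simp)

noncomputable instance instDSpProd : DSp M (Γ × Δ) where
  enc p := pr (enc p.1) (enc p.2)
  inj := by
    rintro ⟨a, b⟩ ⟨c, d⟩ h
    obtain ⟨h1, h2⟩ := pr_inj.1 h
    exact Prod.ext (inj h1) (inj h2)
  rng := by
    refine Raw.congr (φ := fun v => ∃ a b, (∃ γ : Γ, enc γ = a) ∧ (∃ δ : Δ, enc δ = b) ∧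
      IsPair (v 0) a b) ?_ ?_
    · exact Raw.ex (Raw.ex (((rng (Γ := Γ)).app 1).and (((rng (Γ := Δ)).app 0).and
        (Raw.isPair 2 1 0))))
    · intro v
      simp [isPair_iff, eq_comm]

theorem enc_prod (p : Γ × Δ) : enc p = pr (enc p.1) (enc p.2) := rfl

theorem enc_self (x : M) : enc x = x := rfl

/-- The complement has to be taken inside the class of codes, which is definable by `rng`.
Injectivity of the coding makes the truth value depend on the code only. -/
instance Dfn.not {φ : Γ → Prop} [h : Dfn φ] : Dfn fun v => ¬ φ v where
  raw := ((rng (Γ := Γ)).and h.raw.not).congr fun v => by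
    constructor
    · rintro ⟨γ, hγ, h⟩
      exact ⟨⟨γ, hγ⟩, fun ⟨γ', h', h''⟩ => h (inj (hγ.trans h'.symm) ▸ h'')⟩
    · rintro ⟨⟨γ, hγ⟩, h⟩
      exact ⟨γ, hγ, fun h' => h ⟨γ, hγ, h'⟩⟩

instance Dfn.and {φ ψ : Γ → Prop} [h : Dfn φ] [h' : Dfn ψ] : Dfn fun v => φ v ∧ ψ v where
  raw := (h.raw.and h'.raw).congr fun v => by
    constructor
    · rintro ⟨γ, hγ, h, h'⟩
      exact ⟨⟨γ, hγ, h⟩, γ, hγ, h'⟩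
    · rintro ⟨⟨γ, hγ, h⟩, γ', hγ', h'⟩
      exact ⟨γ, hγ, h, inj (hγ.trans hγ'.symm) ▸ h'⟩

instance Dfn.or {φ ψ : Γ → Prop} [Dfn φ] [Dfn ψ] : Dfn fun v => φ v ∨ ψ v :=
  (Dfn.not (φ := fun v => ¬ φ v ∧ ¬ ψ v)).congr fun v => by tauto

instance Dfn.imp {φ ψ : Γ → Prop} [Dfn φ] [Dfn ψ] : Dfn fun v => φ v → ψ v :=
  (Dfn.not (φ := fun v => φ v ∧ ¬ ψ v)).congr fun v => by tauto

instance Dfn.iff {φ ψ : Γ → Prop} [Dfn φ] [Dfn ψ] : Dfn fun v => φ v ↔ ψ v :=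
  (Dfn.and (φ := fun v => φ v → ψ v) (ψ := fun v => ψ v → φ v)).congr fun v => by tauto

instance Dfn.ex {φ : Γ → Δ → Prop} [h : Dfn fun p : Γ × Δ => φ p.1 p.2] :
    Dfn fun v => ∃ x, φ v x where
  raw := by
    refine Raw.congr (φ := fun v => ∃ y z, IsPair z (v 0) y ∧
      ∃ p : Γ × Δ, enc p = z ∧ φ p.1 p.2) ?_ ?_
    · exact Raw.ex (Raw.ex ((Raw.isPair 0 2 1).and (h.raw.app 0)))
    · intro v
      constructor
      · rintro ⟨γ, hγ, δ, hδ⟩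
        exact ⟨enc δ, enc (γ, δ), hγ ▸ isPair_pr _ _, (γ, δ), rfl, hδ⟩
      · rintro ⟨y, z, hz, ⟨γ, δ⟩, rfl, h⟩
        exact ⟨γ, ((isPair_pr _ _).inj hz).1, δ, h⟩

instance Dfn.all {φ : Γ → Δ → Prop} [h : Dfn fun p : Γ × Δ => φ p.1 p.2] :
    Dfn fun v => ∀ x, φ v x :=
  (Dfn.not (φ := fun v => ∃ x, ¬ φ v x)).congr fun v => by simp

theorem Dfn.comp {φ : Δ → Prop} (h : Dfn φ) (f : Γ → Δ) [hf : DFun f] : Dfn fun v => φ (f v) where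
  raw := by
    refine Raw.congr (φ := fun v => ∃ y, (∃ γ, enc γ = v 0 ∧ enc (f γ) = y) ∧
      ∃ δ : Δ, enc δ = y ∧ φ δ) ?_ ?_
    · exact Raw.ex ((hf.raw.app 1 0).and (h.raw.app 0))
    · intro v
      constructor
      · rintro ⟨γ, hγ, h⟩
        exact ⟨_, ⟨γ, hγ, rfl⟩, _, rfl, h⟩
      · rintro ⟨y, ⟨γ, hγ, rfl⟩, δ, hδ, h⟩
        exact ⟨γ, hγ, inj hδ ▸ h⟩

theorem DFun.comp {g : Δ → E} (hg : DFun g) (f : Γ → Δ) [hf : DFun f] :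
    DFun fun v => g (f v) where
  raw := by
    refine Raw.congr (φ := fun v => ∃ y, (∃ γ, enc γ = v 0 ∧ enc (f γ) = y) ∧
      ∃ δ : Δ, enc δ = y ∧ enc (g δ) = v 1) ?_ ?_
    · exact Raw.ex ((hf.raw.app 1 0).and (hg.raw.app 0 2))
    · intro v
      constructor
      · rintro ⟨γ, hγ, h⟩
        exact ⟨_, ⟨γ, hγ, rfl⟩, _, rfl, h⟩
      · rintro ⟨y, ⟨γ, hγ, rfl⟩, δ, hδ, h⟩
        exact ⟨γ, hγ, inj hδ ▸ h⟩

instance (priority := low) DFun.pair {f : Γ → Δ} {g : Γ → E} [hf : DFun f] [hg : DFun g] :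
    DFun fun v => (f v, g v) where
  raw := by
    refine Raw.congr (φ := fun v => ∃ a b, (∃ γ, enc γ = v 0 ∧ enc (f γ) = a) ∧
      (∃ γ, enc γ = v 0 ∧ enc (g γ) = b) ∧ IsPair (v 1) a b) ?_ ?_
    · exact Raw.ex (Raw.ex ((hf.raw.app 2 1).and ((hg.raw.app 2 0).and (Raw.isPair 3 1 0))))
    · intro v
      constructor
      · rintro ⟨γ, hγ, h⟩
        exact ⟨_, _, ⟨γ, hγ, rfl⟩, ⟨γ, hγ, rfl⟩, h ▸ isPair_pr _ _⟩
      · rintro ⟨a, b, ⟨γ, hγ, rfl⟩, ⟨γ', hγ', rfl⟩, h⟩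
        obtain rfl := inj (hγ.trans hγ'.symm)
        exact ⟨γ, hγ, (isPair_iff.1 h).symm⟩

instance (priority := high) DFun.id : DFun fun v : Γ => v where
  raw := (((rng (Γ := Γ)).app 0).and (Raw.eq 0 1)).congr fun v => by aesop

instance (priority := high) DFun.fst' : DFun (Prod.fst : Γ × Δ → Γ) where
  raw := by
    refine Raw.congr (φ := fun v => ∃ b, (∃ γ : Γ, enc γ = v 1) ∧ (∃ δ : Δ, enc δ = b) ∧
      IsPair (v 0) (v 1) b) ?_ ?_
    · exact Raw.ex (((rng (Γ := Γ)).app 2).and (((rng (Γ := Δ)).app 0).and (Raw.isPair 1 2 0)))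
    · intro v
      simp only [isPair_iff, Prod.exists, enc_prod]
      constructor
      · rintro ⟨a, b, h, h'⟩
        exact ⟨_, ⟨a, h'⟩, ⟨b, rfl⟩, h' ▸ h.symm⟩
      · rintro ⟨_, ⟨a, h⟩, ⟨b, rfl⟩, h'⟩
        exact ⟨a, b, h ▸ h'.symm, h⟩

instance (priority := high) DFun.snd' : DFun (Prod.snd : Γ × Δ → Δ) where
  raw := by
    refine Raw.congr (φ := fun v => ∃ b, (∃ γ : Γ, enc γ = b) ∧ (∃ δ : Δ, enc δ = v 1) ∧
      IsPair (v 0) b (v 1)) ?_ ?_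
    · exact Raw.ex (((rng (Γ := Γ)).app 0).and (((rng (Γ := Δ)).app 2).and (Raw.isPair 1 0 2)))
    · intro v
      simp only [isPair_iff, Prod.exists, enc_prod]
      constructor
      · rintro ⟨a, b, h, h'⟩
        exact ⟨_, ⟨a, rfl⟩, ⟨b, h'⟩, h' ▸ h.symm⟩
      · rintro ⟨_, ⟨a, rfl⟩, ⟨b, h⟩, h'⟩
        exact ⟨a, b, h ▸ h'.symm, h⟩

instance (priority := high) DFun.fst {f : Γ → Δ × E} [DFun f] : DFun fun v => (f v).1 := DFun.fst'.comp f

instance (priority := high) DFun.snd {f : Γ → Δ × E} [DFun f] : DFun fun v => (f v).2 := DFun.snd'.comp f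

instance DFun.const (c : Δ) : DFun fun _ : Γ => c where
  raw := (((rng (Γ := Γ)).app 0).and (Raw.eq_const 1 (enc c))).congr fun v => by
    simp [eq_comm]

instance DFun.prodMk (c : Γ) : DFun (Prod.mk c : Δ → Γ × Δ) :=
  DFun.pair (f := fun _ => c) (g := fun v => v)

instance DFun.enc {f : Γ → Δ} [DFun f] : DFun fun v => enc (f v) :=
  DFun.comp (g := fun x : Δ => DSp.enc x) ⟨(((rng (Γ := Δ)).app 0).and (Raw.eq 0 1)).congr
    fun v => by
      simp only [enc_self]
      aesop⟩ f

theorem Dfn.eq' : Dfn fun v : Γ × Γ => v.1 = v.2 where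
  raw := by
    refine Raw.congr (φ := fun v => ∃ b, (∃ γ : Γ, DSp.enc γ = b) ∧ IsPair (v 0) b b) ?_ ?_
    · exact Raw.ex (((rng (Γ := Γ)).app 0).and (Raw.isPair 1 0 0))
    · intro v
      simp only [isPair_iff, Prod.exists, enc_prod]
      constructor
      · rintro ⟨a, b, h, rfl⟩
        exact ⟨_, ⟨a, rfl⟩, h.symm⟩
      · rintro ⟨_, ⟨a, rfl⟩, h⟩
        exact ⟨a, a, h.symm, rfl⟩

theorem Dfn.mem' : Dfn fun v : M × M => v.1 ∈ᴹ v.2 where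
  raw := by
    refine Raw.congr (φ := fun v => ∃ a b, a ∈ᴹ b ∧ IsPair (v 0) a b) ?_ ?_
    · exact Raw.ex (Raw.ex ((Raw.mem 1 0).and (Raw.isPair 2 1 0)))
    · intro v
      simp [isPair_iff, Prod.exists, enc_prod, enc_self, eq_comm, and_comm]

instance Dfn.eq {f g : Γ → Δ} [DFun f] [DFun g] : Dfn fun v => f v = g v :=
  Dfn.eq'.comp fun v => (f v, g v)

instance Dfn.mem {f g : Γ → M} [DFun f] [DFun g] : Dfn fun v => f v ∈ᴹ g v :=
  Dfn.mem'.comp fun v => (f v, g v)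

instance Dfn.eq_left (c : Γ) : Dfn (Eq c) := Dfn.eq (f := fun _ => c) (g := fun v => v)

instance Dfn.const (p : Prop) : Dfn fun _ : Γ => p := by
  by_cases h : p
  · exact (inferInstance : Dfn fun v : Γ => v = v).congr (by simp [h])
  · exact (inferInstance : Dfn fun v : Γ => ¬ v = v).congr (by simp [h])

instance Dfn.exUnique {φ : Γ → Δ → Prop} [h : Dfn fun p : Γ × Δ => φ p.1 p.2] :
    Dfn fun v => ∃! x, φ v x := by
  have h1 : Dfn fun p : (Γ × Δ) × Δ => φ p.1.1 p.2 :=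
    h.comp fun p : (Γ × Δ) × Δ => (p.1.1, p.2)
  unfold ExistsUnique
  infer_instance

/-- A function with a definable graph is definable. -/
theorem DFun.of_graph {f : Γ → Δ} {R : Γ → Δ → Prop} (h : Dfn fun p : Γ × Δ => R p.1 p.2)
    (e : ∀ v y, R v y ↔ f v = y) : DFun f where
  raw := by
    refine Raw.congr (φ := fun v => ∃ z, IsPair z (v 0) (v 1) ∧
      ∃ p : Γ × Δ, DSp.enc p = z ∧ R p.1 p.2) ?_ ?_
    · exact Raw.ex ((Raw.isPair 0 1 2).and (h.raw.app 0))
    · intro v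
      simp only [e]
      constructor
      · rintro ⟨γ, hγ, h⟩
        exact ⟨DSp.enc (γ, f γ), by rw [← hγ, ← h]; exact isPair_pr _ _, (γ, f γ), rfl, rfl⟩
      · rintro ⟨z, hz, ⟨γ, δ⟩, rfl, h⟩
        obtain ⟨h1, h2⟩ := (isPair_pr _ _).inj hz
        dsimp only at h
        exact ⟨γ, h1, by rw [h]; exact h2⟩

instance instDSpSubtype {P : M → Prop} [h : Dfn fun x => P x] : DSp M {x : M // P x} where
  enc x := x.1
  inj := Subtype.val_injective
  rng := h.raw.congr fun v => by simp [enc_self]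

instance DFun.val {P : M → Prop} [h : Dfn fun x => P x] {f : Γ → {x : M // P x}} [DFun f] :
    DFun fun v => (f v).1 :=
  inferInstanceAs (DFun fun v => DSp.enc (f v))

instance (priority := low) DFun.subtypeMk {P : M → Prop} [Dfn fun x => P x] {f : Γ → M} [hf : DFun f]
    {hP : ∀ v, P (f v)} : DFun fun v => (⟨f v, hP v⟩ : {x : M // P x}) :=
  have := hf.comp (fun p : Γ × {x : M // P x} => p.1)
  DFun.of_graph (R := fun v y => f v = y.1) inferInstance fun v y => by
    rw [Subtype.ext_iff]

/-- Closure under substitution, with the substituted map quantified inside the conclusion: put into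
the context by `have`, such a statement acts as a local instance, so that instance search can treat
a variable predicate or map like a built-in one. -/
theorem Dfn.clo₁ {φ : Γ → Prop} (h : Dfn φ) :
    ∀ (Γ' : Type u) [DSp M Γ'] (g : Γ' → Γ) [DFun g], Dfn fun v => φ (g v) :=
  fun _ _ g _ => h.comp g

theorem Dfn.clo₂ {φ : Γ → Δ → Prop} (h : Dfn fun p : Γ × Δ => φ p.1 p.2) :
    ∀ (Γ' : Type u) [DSp M Γ'] (f : Γ' → Γ) (g : Γ' → Δ) [DFun f] [DFun g],
      Dfn fun v => φ (f v) (g v) :=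
  fun _ _ f g _ _ => h.comp fun v => (f v, g v)

theorem Dfn.clo₃ {φ : Γ → Δ → E → Prop} (h : Dfn fun p : Γ × Δ × E => φ p.1 p.2.1 p.2.2) :
    ∀ (Γ' : Type u) [DSp M Γ'] (f : Γ' → Γ) (g : Γ' → Δ) (k : Γ' → E) [DFun f] [DFun g] [DFun k],
      Dfn fun v => φ (f v) (g v) (k v) :=
  fun _ _ f g k _ _ _ => h.comp fun v => (f v, g v, k v)

theorem DFun.clo₁ {φ : Γ → Δ} (h : DFun φ) :
    ∀ (Γ' : Type u) [DSp M Γ'] (g : Γ' → Γ) [DFun g], DFun fun v => φ (g v) :=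
  fun _ _ g _ => h.comp g

theorem DFun.clo₂ {φ : Γ → Δ → E} (h : DFun fun p : Γ × Δ => φ p.1 p.2) :
    ∀ (Γ' : Type u) [DSp M Γ'] (f : Γ' → Γ) (g : Γ' → Δ) [DFun f] [DFun g],
      DFun fun v => φ (f v) (g v) :=
  fun _ _ f g _ _ => h.comp fun v => (f v, g v)

theorem DFun.clo₃ {Z : Type u} [DSp M Z] {φ : Γ → Δ → E → Z}
    (h : DFun fun p : Γ × Δ × E => φ p.1 p.2.1 p.2.2) :
    ∀ (Γ' : Type u) [DSp M Γ'] (f : Γ' → Γ) (g : Γ' → Δ) (k : Γ' → E) [DFun f] [DFun g] [DFun k],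
      DFun fun v => φ (f v) (g v) (k v) :=
  fun _ _ f g k _ _ _ => h.comp fun v => (f v, g v, k v)

end DSp

open DSp

variable {M : Type u} [setLang.Structure M] [hM : Fact (IsModelZF M)]
variable {Γ Δ E : Type u} [DSp M Γ] [DSp M Δ] [DSp M E]

/-! ### Sets given by definable conditions -/

theorem exists_sep (a : M) (P : M → Prop) [h : Dfn P] : ∃ c, ∀ x, x ∈ᴹ c ↔ x ∈ᴹ a ∧ P x :=
  hM.out.separation P (h.raw.congr fun v => by simp [enc_self]) a

open Classical in
/-- The set of all elements of `a` with the definable property `P`. -/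
noncomputable def sep (a : M) (P : M → Prop) : M :=
  -- The default value lets `sep` be written without a proof of definability; `mem_sep` asks for
  -- that proof.
  if h : ∃ c, ∀ x, x ∈ᴹ c ↔ x ∈ᴹ a ∧ P x then h.choose else a

theorem mem_sep {a : M} {P : M → Prop} [Dfn P] {x : M} : x ∈ᴹ sep a P ↔ x ∈ᴹ a ∧ P x := by
  have h := exists_sep a P
  rw [sep, dif_pos h]
  exact h.choose_spec x

theorem Dfn.section {P : Γ → Δ → Prop} (h : Dfn fun p : Γ × Δ => P p.1 p.2) (v : Γ) :
    Dfn (P v) :=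
  h.comp fun x => (v, x)

/-- By extensionality the separated set is the only one with the right elements, and that condition
is a definable graph. -/
instance DFun.sep {a : Γ → M} {P : Γ → M → Prop} [DFun a] [h : Dfn fun p : Γ × M => P p.1 p.2] :
    DFun fun v => sep (a v) (P v) := by
  have h1 : Dfn fun p : (Γ × M) × M => P p.1.1 p.2 := h.comp fun p : (Γ × M) × M => (p.1.1, p.2)
  have h2 := (‹DFun a›).comp fun p : (Γ × M) × M => p.1.1
  refine DFun.of_graph (R := fun v y => ∀ x, x ∈ᴹ y ↔ x ∈ᴹ a v ∧ P v x) inferInstance ?_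
  intro v y
  have := h.section v
  exact ⟨fun h => ext fun x => mem_sep.trans (h x).symm, by rintro rfl x; exact mem_sep⟩

theorem exists_image (a : M) (R : M → M → Prop) [h : Dfn fun p : M × M => R p.1 p.2]
    (hR : ∀ x, x ∈ᴹ a → ∀ y y', R x y → R x y' → y = y') :
    ∃ c, ∀ y, y ∈ᴹ c ↔ ∃ x, x ∈ᴹ a ∧ R x y := by
  refine hM.out.replacement R ?_ a hR
  refine Raw.congr (φ := fun v : Fin 2 → M => ∃ z, IsPair z (v 0) (v 1) ∧
    ∃ p : M × M, enc p = z ∧ R p.1 p.2) ?_ ?_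
  · exact Raw.ex ((Raw.isPair 0 1 2).and (h.raw.app 0))
  · intro v
    constructor
    · intro h
      exact ⟨pr (v 0) (v 1), isPair_pr _ _, (v 0, v 1), rfl, h⟩
    · rintro ⟨z, hz, p, rfl, h⟩
      obtain ⟨h1, h2⟩ := hz.inj (isPair_pr _ _)
      simp only [enc_self] at h1 h2
      change R (v 0) (v 1)
      rwa [h1, h2]

instance DFun.pr {f g : Γ → M} [DFun f] [DFun g] : DFun fun v => pr (f v) (g v) :=
  inferInstanceAs (DFun fun v => DSp.enc (f v, g v))

instance Dfn.sub {f g : Γ → M} [DFun f] [DFun g] : Dfn fun v => Sub (f v) (g v) := by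
  have h : Dfn fun v : M × M => Sub v.1 v.2 := by
    unfold Sub
    infer_instance
  exact h.comp fun v => (f v, g v)

theorem exists_pow (a : M) : ∃ c, ∀ x, x ∈ᴹ c ↔ Sub x a := hM.out.powerset a

theorem Sub.antisymm {a b : M} (h : Sub a b) (h' : Sub b a) : a = b :=
  ext fun x => ⟨h x, h' x⟩

/-- The powerset. -/
noncomputable def pow (a : M) : M := (exists_pow a).choose

theorem mem_pow {a x : M} : x ∈ᴹ pow a ↔ Sub x a := (exists_pow a).choose_spec x

theorem exists_insert (a b : M) : ∃ c, ∀ x, x ∈ᴹ c ↔ x ∈ᴹ a ∨ x = b := by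
  obtain ⟨s, hs⟩ := exists_upair b b
  obtain ⟨t, ht⟩ := exists_upair a s
  obtain ⟨c, hc⟩ := hM.out.union t
  refine ⟨c, fun x => (hc x).trans ?_⟩
  constructor
  · rintro ⟨y, hy, hx⟩
    rcases (ht y).1 hy with rfl | rfl
    · exact .inl hx
    · exact .inr (((hs x).1 hx).elim _root_.id _root_.id)
  · rintro (h | rfl)
    · exact ⟨a, (ht a).2 (.inl rfl), h⟩
    · exact ⟨s, (ht s).2 (.inr rfl), (hs x).2 (.inl rfl)⟩

/-- `a ∪ {b}`. -/
noncomputable def ins (a b : M) : M := (exists_insert a b).choose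

theorem mem_ins {a b x : M} : x ∈ᴹ ins a b ↔ x ∈ᴹ a ∨ x = b := (exists_insert a b).choose_spec x

instance DFun.ins {f g : Γ → M} [DFun f] [DFun g] : DFun fun v => ins (f v) (g v) := by
  have h : DFun fun v : M × M => SetModel.ins v.1 v.2 := by
    refine DFun.of_graph (R := fun v y => ∀ x, x ∈ᴹ y ↔ x ∈ᴹ v.1 ∨ x = v.2) inferInstance ?_
    intro v y
    exact ⟨fun h => ext fun x => mem_ins.trans (h x).symm, by rintro rfl x; exact mem_ins⟩
  exact h.comp fun v => (f v, g v)

theorem app_iff {f a b : M} : App f a b ↔ pr a b ∈ᴹ f := by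
  simp [App, isPair_iff]

theorem isPair_iff_eq : (IsPair : M → M → M → Prop) = fun c a b => c = pr a b := by
  funext a b c
  exact propext isPair_iff

theorem app_eq : (App : M → M → M → Prop) = fun f a b => pr a b ∈ᴹ f := by
  funext a b c
  exact propext app_iff

instance Dfn.isPair {a b c : Γ → M} [DFun a] [DFun b] [DFun c] :
    Dfn fun v => IsPair (a v) (b v) (c v) := by
  rw [isPair_iff_eq]
  infer_instance

instance Dfn.app {a b c : Γ → M} [DFun a] [DFun b] [DFun c] :
    Dfn fun v => App (a v) (b v) (c v) := by
  rw [app_eq]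
  infer_instance

/-! ### Natural numbers -/

variable (M) in
theorem exists_empty : ∃ e : M, IsEmptySet e := by
  obtain ⟨w, ⟨e, -, he⟩, -⟩ := hM.out.infinity
  exact ⟨e, he⟩

instance Dfn.isEmptySet {a : Γ → M} [DFun a] : Dfn fun v => IsEmptySet (a v) := by
  have h : Dfn fun v : M => IsEmptySet v := by
    unfold IsEmptySet
    infer_instance
  exact h.comp fun v => a v

theorem isSucc_iff {s n : M} : IsSucc s n ↔ s = ins n n :=
  ⟨fun h => ext fun x => (h x).trans mem_ins.symm, by rintro rfl x; exact mem_ins⟩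

theorem isSucc_eq : (IsSucc : M → M → Prop) = fun s n => s = ins n n := by
  funext a b
  exact propext isSucc_iff

instance Dfn.isSucc {a b : Γ → M} [DFun a] [DFun b] : Dfn fun v => IsSucc (a v) (b v) := by
  rw [isSucc_eq]
  infer_instance

instance Dfn.isInductive {a : Γ → M} [DFun a] : Dfn fun v => IsInductive (a v) := by
  have h : Dfn fun v : M => IsInductive v := by
    unfold IsInductive
    infer_instance
  exact h.comp fun v => a v

instance Dfn.isNat {a : Γ → M} [DFun a] : Dfn fun v => IsNat (a v) := by
  have h : Dfn fun v : M => IsNat v := by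
    unfold IsNat
    infer_instance
  exact h.comp fun v => a v

instance Dfn.isNat' : Dfn fun v : M => IsNat v := Dfn.isNat (a := fun v => v)

variable (M) in
/-- The natural numbers of the model `M`. -/
abbrev N : Type u := {n : M // IsNat n}

theorem isNat_of_isEmptySet {e : M} (he : IsEmptySet e) : IsNat e := by
  rintro w ⟨⟨e', h, he'⟩, -⟩
  rwa [show e = e' from ext fun x => iff_of_false (he x) (he' x)]

theorem isNat_succ {n : M} (hn : IsNat n) : IsNat (ins n n) := by
  rintro w hw
  obtain ⟨s, hs, h⟩ := hw.2 n (hn w hw)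
  rwa [← isSucc_iff.1 h]

variable (M) in
theorem exists_omega : ∃ w : M, ∀ x, x ∈ᴹ w ↔ IsNat x := by
  obtain ⟨w, hw⟩ := hM.out.infinity
  exact ⟨sep w fun x => IsNat x, fun x => mem_sep.trans (and_iff_right_of_imp fun h => h w hw)⟩

variable (M) in
/-- The set of natural numbers. -/
noncomputable def omega : M := (exists_omega M).choose

theorem mem_omega {x : M} : x ∈ᴹ omega M ↔ IsNat x := (exists_omega M).choose_spec x

noncomputable instance : Zero (N M) :=
  ⟨⟨(exists_empty M).choose, isNat_of_isEmptySet (exists_empty M).choose_spec⟩⟩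

theorem N.zero_spec (x : M) : ¬ x ∈ᴹ (0 : N M).1 := (exists_empty M).choose_spec x

theorem isEmptySet_iff {e : M} : IsEmptySet e ↔ e = (0 : N M).1 :=
  ⟨fun h => ext fun x => iff_of_false (h x) (N.zero_spec x), by rintro rfl; exact N.zero_spec⟩

/-- The successor of a natural number. -/
noncomputable def N.succ (n : N M) : N M := ⟨ins n.1 n.1, isNat_succ n.2⟩

theorem N.isSucc_iff {s : M} {n : N M} : IsSucc s n.1 ↔ s = n.succ.1 := SetModel.isSucc_iff

instance DFun.nsucc {f : Γ → N M} [DFun f] : DFun fun v => N.succ (f v) := by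
  unfold N.succ
  infer_instance

/-- Separation makes the elements of `omega M` that satisfy `P` into an inductive set of `M`, and
natural numbers lie in every inductive set. Since `N M` may be nonstandard, definability of `P` is
essential. -/
theorem N.ind {P : N M → Prop} [hP : Dfn P] (h0 : P 0) (hs : ∀ n, P n → P n.succ) (n : N M) :
    P n := by
  have := hP.clo₁
  have h := n.2 (sep (omega M) fun x => ∃ n : N M, n.1 = x ∧ P n) ?_
  · obtain ⟨-, m, hm, h⟩ := mem_sep.1 h
    rwa [Subtype.ext hm] at h
  · refine ⟨⟨(0 : N M).1, mem_sep.2 ⟨mem_omega.2 (0 : N M).2, 0, rfl, h0⟩, N.zero_spec⟩, ?_⟩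
    intro x hx
    obtain ⟨-, m, rfl, h⟩ := mem_sep.1 hx
    exact ⟨m.succ.1, mem_sep.2 ⟨mem_omega.2 m.succ.2, m.succ, rfl, hs m h⟩, N.isSucc_iff.2 rfl⟩

theorem N.mem_succ {x : M} {n : N M} : x ∈ᴹ n.succ.1 ↔ x ∈ᴹ n.1 ∨ x = n.1 := mem_ins

theorem N.isNat_of_mem {x : M} {n : N M} : x ∈ᴹ n.1 → IsNat x := by
  refine N.ind (P := fun n : N M => ∀ x, x ∈ᴹ n.1 → IsNat x) (fun x h => (N.zero_spec x h).elim)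
    ?_ n x
  intro n ih x hx
  rcases N.mem_succ.1 hx with h | rfl
  exacts [ih x h, n.2]

theorem N.mem_trans {x y : M} {n : N M} : x ∈ᴹ y → y ∈ᴹ n.1 → x ∈ᴹ n.1 := by
  refine N.ind (P := fun n : N M => ∀ x y, x ∈ᴹ y → y ∈ᴹ n.1 → x ∈ᴹ n.1)
    (fun x y _ h => (N.zero_spec y h).elim) ?_ n x y
  intro n ih x y hx hy
  rcases N.mem_succ.1 hy with h | rfl
  exacts [N.mem_succ.2 (.inl (ih x y hx h)), N.mem_succ.2 (.inl hx)]

theorem N.mem_irrefl (n : N M) : ¬ n.1 ∈ᴹ n.1 := by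
  refine N.ind (P := fun n : N M => ¬ n.1 ∈ᴹ n.1) (N.zero_spec _) ?_ n
  intro n ih h
  have h1 : n.1 ∈ᴹ n.succ.1 := N.mem_succ.2 (.inr rfl)
  rcases N.mem_succ.1 h with h2 | h2
  · exact ih (N.mem_trans h1 h2)
  · rw [h2] at h1
    exact ih h1

instance : LE (N M) := ⟨fun m n => NatLe m.1 n.1⟩

instance : LT (N M) := ⟨fun m n => m.1 ∈ᴹ n.1⟩

omit hM in
theorem N.le_iff {m n : N M} : m ≤ n ↔ m < n ∨ m = n := by
  rw [Subtype.ext_iff]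
  rfl

instance Dfn.nlt {f g : Γ → N M} [DFun f] [DFun g] : Dfn fun v => f v < g v :=
  inferInstanceAs (Dfn fun v => (f v).1 ∈ᴹ (g v).1)

instance Dfn.nle {f g : Γ → N M} [DFun f] [DFun g] : Dfn fun v => f v ≤ g v :=
  inferInstanceAs (Dfn fun v => (f v).1 ∈ᴹ (g v).1 ∨ (f v).1 = (g v).1)

instance Dfn.nlt_left (c : N M) : Dfn (LT.lt c) := Dfn.nlt (f := fun _ => c) (g := fun v => v)

instance Dfn.nle_left (c : N M) : Dfn (LE.le c) := Dfn.nle (f := fun _ => c) (g := fun v => v)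

instance Dfn.natLe {f g : Γ → M} [DFun f] [DFun g] : Dfn fun v => NatLe (f v) (g v) :=
  inferInstanceAs (Dfn fun v => f v ∈ᴹ g v ∨ f v = g v)

theorem N.lt_succ {m n : N M} : m < n.succ ↔ m ≤ n := N.mem_succ

theorem N.lt_succ_self (n : N M) : n < n.succ := N.lt_succ.2 (.inr rfl)

theorem N.not_lt_zero (n : N M) : ¬ n < 0 := N.zero_spec _

protected theorem N.zero_le (n : N M) : 0 ≤ n := by
  refine N.ind (P := fun n : N M => 0 ≤ n) (.inr rfl) ?_ n
  intro n ih
  exact .inl (N.lt_succ.2 ih)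

theorem N.succ_le {m n : N M} (h : m < n) : m.succ ≤ n := by
  refine N.ind (P := fun n : N M => ∀ m, m < n → m.succ ≤ n) (fun m h => (N.not_lt_zero _ h).elim)
    ?_ n m h
  intro n ih m h
  rcases N.le_iff.1 (N.lt_succ.1 h) with h | rfl
  · exact .inl (N.lt_succ.2 (ih m h))
  · exact .inr rfl

theorem N.trichotomy (m n : N M) : m < n ∨ m = n ∨ n < m := by
  refine N.ind (P := fun n : N M => m < n ∨ m = n ∨ n < m) ?_ ?_ n
  · rcases N.le_iff.1 (N.zero_le m) with h | rfl
    exacts [.inr (.inr h), .inr (.inl rfl)]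
  · rintro n (h | rfl | h)
    · exact .inl (N.lt_succ.2 (.inl h))
    · exact .inl (N.lt_succ_self _)
    · rcases N.le_iff.1 (N.succ_le h) with h | h
      exacts [.inr (.inr h), .inr (.inl h.symm)]

theorem N.lt_trans' {a b c : N M} (h : a < b) (h' : b < c) : a < c := N.mem_trans h h'

noncomputable instance : LinearOrder (N M) where
  le_refl n := .inr rfl
  le_trans a b c h h' := by
    rw [N.le_iff] at *
    rcases h with h | rfl
    · rcases h' with h' | rfl
      exacts [.inl (N.lt_trans' h h'), .inl h]
    · exact h'
  lt_iff_le_not_ge a b := by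
    rw [N.le_iff, N.le_iff]
    constructor
    · refine fun h => ⟨.inl h, ?_⟩
      rintro (h' | rfl)
      exacts [N.mem_irrefl a (N.lt_trans' h h'), N.mem_irrefl _ h]
    · rintro ⟨h | h, h'⟩
      exacts [h, (h' (.inr h.symm)).elim]
  le_antisymm a b h h' := by
    rw [N.le_iff] at *
    rcases h with h | rfl
    · rcases h' with h' | rfl
      exacts [(N.mem_irrefl a (N.lt_trans' h h')).elim, rfl]
    · rfl
  le_total a b := by
    rw [N.le_iff, N.le_iff]
    rcases N.trichotomy a b with h | h | h
    exacts [.inl (.inl h), .inl (.inr h), .inr (.inl h)]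
  toDecidableLE := Classical.decRel _

theorem N.succ_le_iff {m n : N M} : m.succ ≤ n ↔ m < n :=
  ⟨fun h => (N.lt_succ_self m).trans_le h, N.succ_le⟩

theorem N.succ_inj {m n : N M} (h : m.succ = n.succ) : m = n :=
  le_antisymm (N.lt_succ.1 (h ▸ N.lt_succ_self m)) (N.lt_succ.1 (h ▸ N.lt_succ_self n))

theorem N.succ_ne_zero (n : N M) : n.succ ≠ 0 := fun h => N.not_lt_zero n (h ▸ N.lt_succ_self n)

/-- Strong induction, in the form that no number below `n` satisfies `P`. Every selection made
inside `M` rests on this. -/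
theorem N.exists_least {P : N M → Prop} [h : Dfn P] (hP : ∃ n, P n) :
    ∃ n, P n ∧ ∀ m, P m → n ≤ m := by
  have := h.clo₁
  by_contra hc
  push Not at hc
  obtain ⟨n, hn⟩ := hP
  refine N.ind (P := fun n : N M => ∀ m, m < n → ¬ P m) (fun m h => (N.not_lt_zero _ h).elim) ?_
    n.succ n (N.lt_succ_self n) hn
  intro n ih m hm hPm
  obtain ⟨k, hk, hkm⟩ := hc m hPm
  exact ih k (hkm.trans_le (N.lt_succ.1 hm)) hk

/-! ### Definitions by recursion -/

/-- `y` is the `n`-th term of the sequence that starts with `a` and whose terms are generated by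
`F`: the set `g` witnesses the computation. -/
def RecRel (a : Γ) (F : N M → Γ → Γ) (n : N M) (y : Γ) : Prop :=
  ∃ g : M, pr n.1 (enc y) ∈ᴹ g ∧ ∀ (i : N M) (z : Γ), pr i.1 (enc z) ∈ᴹ g →
    (i = 0 ∧ z = a) ∨ ∃ (j : N M) (w : Γ), i = j.succ ∧ z = F j w ∧ pr j.1 (enc w) ∈ᴹ g

instance Dfn.recRel {a : Δ → Γ} {F : Δ → N M → Γ → Γ} {n : Δ → N M} {y : Δ → Γ} [DFun a]
    [hF : DFun fun p : Δ × (N M × Γ) => F p.1 p.2.1 p.2.2] [DFun n] [DFun y] :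
    Dfn fun v => RecRel (a v) (F v) (n v) (y v) := by
  have h1 := hF.clo₃
  have h2 := DFun.clo₁ ‹DFun a›
  have h3 := DFun.clo₁ ‹DFun n›
  have h4 := DFun.clo₁ ‹DFun y›
  unfold RecRel
  infer_instance

section Rec

variable {a : Γ} {F : N M → Γ → Γ} [hF : DFun fun p : N M × Γ => F p.1 p.2]

/-- The two witnesses may differ as sets, so the induction compares entries of the one with entries
of the other at the same index; each entry is justified by one at the preceding index. -/
theorem RecRel.unique {n : N M} {y y' : Γ} (h : RecRel a F n y) (h' : RecRel a F n y') :
    y = y' := by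
  have h1 := hF.clo₂
  obtain ⟨g, hy, hg⟩ := h
  obtain ⟨g', hy', hg'⟩ := h'
  refine N.ind (P := fun n : N M => ∀ y y' : Γ, pr n.1 (enc y) ∈ᴹ g → pr n.1 (enc y') ∈ᴹ g' →
    y = y') ?_ ?_ n y y' hy hy'
  · intro y y' h h'
    rcases hg _ _ h with ⟨-, rfl⟩ | ⟨j, w, hj, -⟩
    · rcases hg' _ _ h' with ⟨-, rfl⟩ | ⟨j, w, hj, -⟩
      exacts [rfl, (N.succ_ne_zero j hj.symm).elim]
    · exact (N.succ_ne_zero j hj.symm).elim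
  · intro n ih y y' h h'
    rcases hg _ _ h with ⟨h, -⟩ | ⟨j, w, hj, rfl, hw⟩
    · exact (N.succ_ne_zero n h).elim
    · rcases hg' _ _ h' with ⟨h, -⟩ | ⟨j', w', hj', rfl, hw'⟩
      · exact (N.succ_ne_zero n h).elim
      · obtain rfl := N.succ_inj hj
        obtain rfl := N.succ_inj hj'
        rw [ih w w' hw hw']

omit hF in
theorem recRel_zero : RecRel a F 0 a := by
  -- As `0` is the empty set, this is the singleton of the pair `(0, a)`.
  refine ⟨ins (0 : N M).1 (pr (0 : N M).1 (enc a)), mem_ins.2 (.inr rfl), ?_⟩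
  intro i z h
  rcases mem_ins.1 h with h | h
  · exact (N.zero_spec _ h).elim
  · obtain ⟨h1, h2⟩ := pr_inj.1 h
    exact .inl ⟨Subtype.ext h1, inj h2⟩

omit hF in
theorem RecRel.succ {n : N M} {y : Γ} (h : RecRel a F n y) : RecRel a F n.succ (F n y) := by
  obtain ⟨g, hy, hg⟩ := h
  refine ⟨ins g (pr n.succ.1 (enc (F n y))), mem_ins.2 (.inr rfl), ?_⟩
  intro i z h
  rcases mem_ins.1 h with h | h
  · rcases hg i z h with h | ⟨j, w, hj, hz, hw⟩
    · exact .inl h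
    · exact .inr ⟨j, w, hj, hz, mem_ins.2 (.inl hw)⟩
  · obtain ⟨h1, h2⟩ := pr_inj.1 h
    exact .inr ⟨n, y, Subtype.ext h1, inj h2, mem_ins.2 (.inl hy)⟩

open Classical in
/-- Definition by recursion on the natural numbers of `M`. -/
noncomputable def natRec (a : Γ) (F : N M → Γ → Γ) (n : N M) : Γ :=
  if h : ∃ y, RecRel a F n y then h.choose else a

theorem recRel_natRec (n : N M) : RecRel a F n (natRec a F n) := by
  have h1 := hF.clo₂
  have h : ∃ y, RecRel a F n y := by
    refine N.ind (P := fun n : N M => ∃ y, RecRel a F n y) ⟨a, recRel_zero⟩ ?_ n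
    rintro n ⟨y, hy⟩
    exact ⟨_, hy.succ⟩
  rw [natRec, dif_pos h]
  exact h.choose_spec

theorem recRel_iff {n : N M} {y : Γ} : RecRel a F n y ↔ natRec a F n = y :=
  ⟨fun h => (recRel_natRec n).unique h, by rintro rfl; exact recRel_natRec n⟩

theorem natRec_zero : natRec a F 0 = a := recRel_iff.1 recRel_zero

theorem natRec_succ (n : N M) : natRec a F n.succ = F n (natRec a F n) :=
  recRel_iff.1 (recRel_natRec n).succ

end Rec

instance DFun.natRec {a : Δ → Γ} {F : Δ → N M → Γ → Γ} {n : Δ → N M} [DFun a]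
    [hF : DFun fun p : Δ × (N M × Γ) => F p.1 p.2.1 p.2.2] [DFun n] :
    DFun fun v => natRec (a v) (F v) (n v) := by
  have h1 := hF.comp fun p : (Δ × Γ) × (N M × Γ) => (p.1.1, p.2)
  have h2 := (‹DFun a›).comp fun p : Δ × Γ => p.1
  have h3 := (‹DFun n›).comp fun p : Δ × Γ => p.1
  refine DFun.of_graph (R := fun v y => RecRel (a v) (F v) (n v) y) inferInstance ?_
  intro v y
  have : DFun fun p : N M × Γ => F v p.1 p.2 := hF.comp fun p : N M × Γ => (v, p)
  exact recRel_iff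

instance DFun.natRec' {a : Γ} {F : N M → Γ → Γ} [hF : DFun fun p : N M × Γ => F p.1 p.2] :
    DFun (SetModel.natRec a F) := by
  have h1 := hF.clo₂
  exact DFun.natRec (a := fun _ => a) (F := fun _ => F) (n := fun n => n)

/-! ### Functions that are elements of the model -/

/-- The class `A` is a set. -/
class IsSmall (A : M → Prop) : Prop where
  ex : ∃ a, ∀ x, x ∈ᴹ a ↔ A x

instance IsSmall.mem (a : M) : IsSmall fun x => x ∈ᴹ a := ⟨a, fun _ => Iff.rfl⟩

instance IsSmall.isNat : IsSmall fun x : M => IsNat x := ⟨omega M, fun _ => mem_omega⟩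

instance IsSmall.natLe (n : N M) : IsSmall fun x : M => NatLe x n.1 :=
  ⟨n.succ.1, fun _ => mem_ins⟩

instance Dfn.isMap {A B : Γ → M → Prop} {f : Γ → M} [DFun f]
    [hA : Dfn fun p : Γ × M => A p.1 p.2] [hB : Dfn fun p : Γ × M => B p.1 p.2] :
    Dfn fun v => IsMap (A v) (B v) (f v) := by
  have h1 := hA.clo₂
  have h2 := hB.clo₂
  have h3 := DFun.clo₁ ‹DFun f›
  unfold IsMap
  infer_instance

/-- The type of the functions from the class `A` to the class `B`. -/
abbrev Mp (A B : M → Prop) : Type u := {f : M // IsMap A B f}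

section Maps

variable {A B : M → Prop}

instance Dfn.isMap' [Dfn fun x => A x] [Dfn fun x => B x] : Dfn fun f : M => IsMap A B f := by
  have h1 := Dfn.clo₁ ‹Dfn fun x => A x›
  have h2 := Dfn.clo₁ ‹Dfn fun x => B x›
  exact Dfn.isMap (A := fun _ => A) (B := fun _ => B) (f := fun v => v)

theorem IsMap.cod {f a b : M} (hf : IsMap A B f) (h : App f a b) : B b := by
  obtain ⟨p, hp, h⟩ := h
  obtain ⟨a', b', -, hb, h'⟩ := hf.1 p h
  rwa [(hp.inj h').2]

theorem IsMap.dom {f a b : M} (hf : IsMap A B f) (h : App f a b) : A a := by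
  obtain ⟨p, hp, h⟩ := h
  obtain ⟨a', b', ha, -, h'⟩ := hf.1 p h
  rwa [(hp.inj h').1]

/-- The value of a function. -/
noncomputable def Mp.ev (f : Mp A B) (a : {x // A x}) : {y // B y} :=
  ⟨(f.2.2 a.1 a.2).choose, f.2.cod (f.2.2 a.1 a.2).choose_spec.1⟩

theorem Mp.app_ev (f : Mp A B) (a : {x // A x}) : App f.1 a.1 (f.ev a).1 :=
  (f.2.2 a.1 a.2).choose_spec.1

theorem Mp.app_iff {f : Mp A B} {a : {x // A x}} {b : M} : App f.1 a.1 b ↔ b = (f.ev a).1 :=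
  ⟨fun h => (f.2.2 a.1 a.2).unique h (f.app_ev a), by rintro rfl; exact f.app_ev a⟩

theorem Mp.app_iff' {f : Mp A B} {a b : M} : App f.1 a b ↔ ∃ h : A a, b = (f.ev ⟨a, h⟩).1 :=
  ⟨fun h => ⟨f.2.dom h, (Mp.app_iff (a := ⟨a, f.2.dom h⟩)).1 h⟩,
    fun ⟨h, e⟩ => (Mp.app_iff (a := ⟨a, h⟩)).2 e⟩

variable [Dfn fun x => A x] [Dfn fun x => B x]

instance DFun.ev {f : Γ → Mp A B} {a : Γ → {x // A x}} [DFun f] [DFun a] :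
    DFun fun v => (f v).ev (a v) := by
  have h : DFun fun p : Mp A B × {x // A x} => p.1.ev p.2 := by
    refine DFun.of_graph (R := fun v y => App v.1.1 v.2.1 y.1) inferInstance ?_
    intro v y
    rw [Mp.app_iff, eq_comm, Subtype.ext_iff]
  exact h.comp fun v => (f v, a v)

instance DFun.ev' (f : Mp A B) : DFun f.ev := DFun.ev (f := fun _ => f) (a := fun a => a)

/-- The passage from definable maps back to elements of `M`: the graph of `g` is the image of the
set `A` under `x ↦ (x, g x)`, hence a set by replacement. -/
theorem exists_map [hA : IsSmall A] (g : {x // A x} → {y // B y}) [hg : DFun g] :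
    ∃ f : Mp A B, ∀ x, f.ev x = g x := by
  obtain ⟨s, hs⟩ := hA.ex
  have h1 := hg.clo₁
  obtain ⟨f, hf⟩ := exists_image s (fun x y => ∃ a : {x // A x}, a.1 = x ∧ y = pr a.1 (g a).1) (by
    rintro x - y y' ⟨a, ha, rfl⟩ ⟨a', ha', rfl⟩
    rw [Subtype.ext (ha.trans ha'.symm)])
  have h2 : ∀ a b, App f a b ↔ ∃ h : A a, b = (g ⟨a, h⟩).1 := by
    intro a b
    rw [SetModel.app_iff, hf]
    constructor
    · rintro ⟨x, -, a', rfl, h⟩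
      obtain ⟨rfl, rfl⟩ := pr_inj.1 h
      exact ⟨a'.2, rfl⟩
    · rintro ⟨h, rfl⟩
      exact ⟨a, (hs a).2 h, ⟨a, h⟩, rfl, rfl⟩
  have h3 : IsMap A B f := by
    constructor
    · intro e he
      obtain ⟨x, -, a, rfl, rfl⟩ := (hf e).1 he
      exact ⟨a.1, (g a).1, a.2, (g a).2, isPair_pr _ _⟩
    · intro a ha
      exact ⟨_, (h2 a _).2 ⟨ha, rfl⟩, fun y hy => ((h2 a y).1 hy).2⟩
  refine ⟨⟨f, h3⟩, fun x => Subtype.ext ?_⟩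
  exact (((Mp.app_iff (f := ⟨f, h3⟩) (a := x)).1 ((h2 x.1 _).2 ⟨x.2, rfl⟩))).symm

end Maps

/-! ### Arithmetic of the natural numbers -/

noncomputable instance : Add (N M) := ⟨fun m n => natRec m (fun _ y => y.succ) n⟩

instance DFun.nadd {f g : Γ → N M} [DFun f] [DFun g] : DFun fun v => f v + g v :=
  inferInstanceAs (DFun fun v => SetModel.natRec (f v) (fun _ y => y.succ) (g v))

instance DFun.nadd_left (c : N M) : DFun (HAdd.hAdd c : N M → N M) :=
  DFun.nadd (f := fun _ => c) (g := fun v => v)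

noncomputable instance : Mul (N M) := ⟨fun m n => natRec 0 (fun _ y => y + m) n⟩

instance DFun.nmul {f g : Γ → N M} [DFun f] [DFun g] : DFun fun v => f v * g v := by
  have := DFun.clo₁ ‹DFun f›
  exact inferInstanceAs (DFun fun v => SetModel.natRec (0 : N M) (fun _ y => y + f v) (g v))

instance DFun.nmul_left (c : N M) : DFun (HMul.hMul c : N M → N M) :=
  DFun.nmul (f := fun _ => c) (g := fun v => v)

namespace N

protected theorem add_zero' (m : N M) : m + 0 = m := natRec_zero

theorem add_succ (m n : N M) : m + n.succ = (m + n).succ := natRec_succ n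

protected theorem mul_zero' (m : N M) : m * 0 = 0 := natRec_zero

theorem mul_succ (m n : N M) : m * n.succ = m * n + m := natRec_succ n

protected theorem zero_add' (n : N M) : 0 + n = n := by
  refine N.ind (P := fun n : N M => 0 + n = n) (N.add_zero' 0) ?_ n
  intro n ih
  rw [add_succ, ih]

theorem succ_add (m n : N M) : m.succ + n = (m + n).succ := by
  refine N.ind (P := fun n : N M => m.succ + n = (m + n).succ) ?_ ?_ n
  · rw [N.add_zero', N.add_zero']
  · intro n ih
    rw [add_succ, ih, add_succ]

protected theorem add_comm' (m n : N M) : m + n = n + m := by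
  refine N.ind (P := fun n : N M => m + n = n + m) ?_ ?_ n
  · rw [N.add_zero', N.zero_add']
  · intro n ih
    rw [add_succ, ih, succ_add]

protected theorem add_assoc' (k m n : N M) : k + m + n = k + (m + n) := by
  refine N.ind (P := fun n : N M => k + m + n = k + (m + n)) ?_ ?_ n
  · rw [N.add_zero', N.add_zero']
  · intro n ih
    rw [add_succ, ih, add_succ, add_succ]

noncomputable instance : AddCommMonoid (N M) where
  add_assoc := N.add_assoc'
  zero_add := N.zero_add'
  add_zero := N.add_zero'
  add_comm := N.add_comm'
  nsmul := nsmulRec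

protected theorem zero_mul' (n : N M) : 0 * n = 0 := by
  refine N.ind (P := fun n : N M => 0 * n = 0) (N.mul_zero' 0) ?_ n
  intro n ih
  rw [mul_succ, ih, N.add_zero']

theorem succ_mul (m n : N M) : m.succ * n = m * n + n := by
  refine N.ind (P := fun n : N M => m.succ * n = m * n + n) ?_ ?_ n
  · rw [N.mul_zero', N.mul_zero', N.add_zero']
  · intro n ih
    rw [mul_succ, ih, mul_succ, add_succ, add_succ, add_right_comm]

protected theorem mul_comm' (m n : N M) : m * n = n * m := by
  refine N.ind (P := fun n : N M => m * n = n * m) ?_ ?_ n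
  · rw [N.mul_zero', N.zero_mul']
  · intro n ih
    rw [mul_succ, ih, succ_mul]

protected theorem mul_add' (k m n : N M) : k * (m + n) = k * m + k * n := by
  refine N.ind (P := fun n : N M => k * (m + n) = k * m + k * n) ?_ ?_ n
  · rw [N.mul_zero', N.add_zero', N.add_zero']
  · intro n ih
    rw [mul_succ, add_succ, mul_succ, ih, add_assoc]

protected theorem mul_assoc' (k m n : N M) : k * m * n = k * (m * n) := by
  refine N.ind (P := fun n : N M => k * m * n = k * (m * n)) ?_ ?_ n
  · rw [N.mul_zero', N.mul_zero', N.mul_zero']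
  · intro n ih
    rw [mul_succ, ih, mul_succ, N.mul_add']

noncomputable instance : One (N M) := ⟨(0 : N M).succ⟩

theorem one_def : (1 : N M) = (0 : N M).succ := rfl

theorem succ_eq (n : N M) : n.succ = n + 1 := by
  rw [one_def, add_succ, add_zero]

protected theorem mul_one' (n : N M) : n * 1 = n := by
  rw [one_def, mul_succ, N.mul_zero', zero_add]

noncomputable instance : CommSemiring (N M) where
  left_distrib := N.mul_add'
  right_distrib a b c := by rw [N.mul_comm', N.mul_add', N.mul_comm' c a, N.mul_comm' c b]
  zero_mul := N.zero_mul'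
  mul_zero := N.mul_zero'
  mul_assoc := N.mul_assoc'
  one_mul n := by rw [N.mul_comm', N.mul_one']
  mul_one := N.mul_one'
  mul_comm := N.mul_comm'
  npow := @npowRec _ ⟨1⟩ ⟨(· * ·)⟩

theorem lt_add_one_iff {m n : N M} : m < n + 1 ↔ m ≤ n := by rw [← succ_eq, lt_succ]

theorem add_one_le_iff {m n : N M} : m + 1 ≤ n ↔ m < n := by rw [← succ_eq, succ_le_iff]

protected theorem add_lt_add_right' {m n : N M} (h : m < n) (k : N M) : m + k < n + k := by
  refine N.ind (P := fun k : N M => m + k < n + k) (by simpa using h) ?_ k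
  intro k ih
  rw [add_succ, add_succ, lt_succ, succ_le_iff]
  exact ih

protected theorem mul_lt_mul_left' {m n : N M} (h : m < n) (k : N M) :
    k.succ * m < k.succ * n := by
  refine N.ind (P := fun k : N M => k.succ * m < k.succ * n) ?_ ?_ k
  · rw [← one_def, one_mul, one_mul]
    exact h
  · intro k ih
    rw [succ_mul k.succ, succ_mul k.succ]
    refine (N.add_lt_add_right' ih m).trans ?_
    rw [add_comm _ m, add_comm _ n]
    exact N.add_lt_add_right' h _

theorem exists_succ {n : N M} (h : n ≠ 0) : ∃ k, n = succ k := by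
  refine N.ind (P := fun n : N M => n ≠ 0 → ∃ k, n = succ k) (fun h => (h rfl).elim) ?_ n h
  exact fun n _ _ => ⟨n, rfl⟩

noncomputable instance : IsStrictOrderedRing (N M) where
  add_le_add_left a b h c := by
    rcases h.lt_or_eq with h | rfl
    exacts [(N.add_lt_add_right' h c).le, le_rfl]
  le_of_add_le_add_left a b c h := by
    by_contra hc
    have := N.add_lt_add_right' (not_le.1 hc) a
    rw [add_comm c, add_comm b] at this
    exact this.not_ge h
  zero_le_one := N.zero_le 1
  exists_pair_ne := ⟨0, 1, (succ_ne_zero 0).symm⟩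
  mul_lt_mul_of_pos_left a ha b c h := by
    obtain ⟨k, rfl⟩ := exists_succ ha.ne'
    exact N.mul_lt_mul_left' h k
  mul_lt_mul_of_pos_right a ha b c h := by
    obtain ⟨k, rfl⟩ := exists_succ ha.ne'
    rw [mul_comm b, mul_comm c]
    exact N.mul_lt_mul_left' h k

end N

/-- Induction shows that any function satisfying the recursion clauses agrees with `i ↦ m + i` up to
`n`; conversely `exists_map` makes this map an element of `M`. -/
theorem natAdd_iff {m n : N M} {k : M} : NatAdd m.1 n.1 k ↔ k = (m + n).1 := by
  constructor
  · rintro ⟨-, -, f, hf, h0, hs, h⟩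
    have key : ∀ i : N M, i ≤ n → App f i.1 (m + i).1 := by
      intro i hi
      refine N.ind (P := fun i : N M => i ≤ n → App f i.1 (m + i).1) ?_ ?_ i hi
      · intro _
        rw [add_zero]
        exact h0 _ N.zero_spec
      · intro i ih hi
        have hi' := N.succ_le_iff.1 hi
        rw [N.add_succ]
        exact hs _ _ _ _ hi' (N.isSucc_iff.2 rfl) (ih hi'.le) (N.isSucc_iff.2 rfl)
    exact (hf.2 n.1 (.inr rfl)).unique h (key n le_rfl)
  · rintro rfl
    have hnat : ∀ i : {i : M // NatLe i n.1}, IsNat i.1 := by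
      rintro ⟨i, h | rfl⟩
      exacts [N.isNat_of_mem h, n.2]
    obtain ⟨f, hf⟩ := exists_map (A := fun i => NatLe i n.1) (B := fun x => IsNat x)
      (fun i => m + ⟨i.1, hnat i⟩)
    refine ⟨m.2, n.2, f.1, f.2, ?_, ?_, ?_⟩
    · intro o ho
      obtain rfl := isEmptySet_iff.1 ho
      refine Mp.app_iff'.2 ⟨N.zero_le n, ?_⟩
      rw [hf, Subtype.coe_eta, add_zero]
    · intro i j v w hi hj hv hw
      obtain ⟨h, rfl⟩ := Mp.app_iff'.1 hv
      rw [hf] at hw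
      let i' : N M := ⟨i, N.isNat_of_mem hi⟩
      obtain rfl := (N.isSucc_iff (n := i')).1 hj
      refine Mp.app_iff'.2 ⟨N.succ_le_iff.2 (show i' < n from hi), ?_⟩
      rw [hf, N.isSucc_iff.1 hw, Subtype.coe_eta, N.add_succ]
    · exact Mp.app_iff'.2 ⟨.inr rfl, by rw [hf]⟩

theorem natMul_iff {m n : N M} {k : M} : NatMul m.1 n.1 k ↔ k = (m * n).1 := by
  constructor
  · rintro ⟨-, -, f, hf, h0, hs, h⟩
    have key : ∀ i : N M, i ≤ n → App f i.1 (m * i).1 := by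
      intro i hi
      refine N.ind (P := fun i : N M => i ≤ n → App f i.1 (m * i).1) ?_ ?_ i hi
      · intro _
        rw [mul_zero]
        exact h0 _ N.zero_spec
      · intro i ih hi
        have hi' := N.succ_le_iff.1 hi
        rw [N.mul_succ]
        exact hs _ _ _ _ hi' (N.isSucc_iff.2 rfl) (ih hi'.le) (natAdd_iff.2 rfl)
    exact (hf.2 n.1 (.inr rfl)).unique h (key n le_rfl)
  · rintro rfl
    have hnat : ∀ i : {i : M // NatLe i n.1}, IsNat i.1 := by
      rintro ⟨i, h | rfl⟩
      exacts [N.isNat_of_mem h, n.2]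
    obtain ⟨f, hf⟩ := exists_map (A := fun i => NatLe i n.1) (B := fun x => IsNat x)
      (fun i => m * ⟨i.1, hnat i⟩)
    refine ⟨m.2, n.2, f.1, f.2, ?_, ?_, ?_⟩
    · intro o ho
      obtain rfl := isEmptySet_iff.1 ho
      refine Mp.app_iff'.2 ⟨N.zero_le n, ?_⟩
      rw [hf, Subtype.coe_eta, mul_zero]
    · intro i j v w hi hj hv hw
      obtain ⟨h, rfl⟩ := Mp.app_iff'.1 hv
      rw [hf] at hw
      let i' : N M := ⟨i, N.isNat_of_mem hi⟩
      obtain rfl := (N.isSucc_iff (n := i')).1 hj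
      refine Mp.app_iff'.2 ⟨N.succ_le_iff.2 (show i' < n from hi), ?_⟩
      rw [hf, natAdd_iff.1 hw, Subtype.coe_eta, N.mul_succ]
    · exact Mp.app_iff'.2 ⟨.inr rfl, by rw [hf]⟩

theorem natMulAddMul_iff {m n m' n' : N M} {k : M} :
    NatMulAddMul m.1 n.1 m'.1 n'.1 k ↔ k = (m * n + m' * n').1 := by
  constructor
  · rintro ⟨s, t, hs, ht, h⟩
    obtain rfl := natMul_iff.1 hs
    obtain rfl := natMul_iff.1 ht
    exact natAdd_iff.1 h
  · rintro rfl
    exact ⟨_, _, natMul_iff.2 rfl, natMul_iff.2 rfl, natAdd_iff.2 rfl⟩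

/-! ### Definability of the arithmetical notions -/

instance Dfn.natAdd {a b c : Γ → M} [DFun a] [DFun b] [DFun c] :
    Dfn fun v => NatAdd (a v) (b v) (c v) := by
  have h : Dfn fun v : M × M × M => NatAdd v.1 v.2.1 v.2.2 := by
    unfold NatAdd
    infer_instance
  exact h.clo₃ _ a b c

instance Dfn.natMul {a b c : Γ → M} [DFun a] [DFun b] [DFun c] :
    Dfn fun v => NatMul (a v) (b v) (c v) := by
  have h : Dfn fun v : M × M × M => NatMul v.1 v.2.1 v.2.2 := by
    unfold NatMul
    infer_instance
  exact h.clo₃ _ a b c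

instance Dfn.natMulAddMul {a b c d e : Γ → M} [DFun a] [DFun b] [DFun c] [DFun d] [DFun e] :
    Dfn fun v => NatMulAddMul (a v) (b v) (c v) (d v) (e v) := by
  have h : Dfn fun v : M × M × M × M × M =>
      NatMulAddMul v.1 v.2.1 v.2.2.1 v.2.2.2.1 v.2.2.2.2 := by
    unfold NatMulAddMul
    infer_instance
  exact h.comp fun v => (a v, b v, c v, d v, e v)

instance Dfn.isFrac {a b c d : Γ → M} [DFun a] [DFun b] [DFun c] [DFun d] :
    Dfn fun v => IsFrac (a v) (b v) (c v) (d v) := by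
  have h : Dfn fun v : M × M × M × M => IsFrac v.1 v.2.1 v.2.2.1 v.2.2.2 := by
    unfold IsFrac
    infer_instance
  exact h.comp fun v => (a v, b v, c v, d v)

instance Dfn.isRat' : Dfn fun v : M => IsRat v := by
  unfold IsRat
  infer_instance

instance Dfn.isRat {a : Γ → M} [DFun a] : Dfn fun v => IsRat (a v) := Dfn.isRat'.comp a

instance Dfn.ratLe {a b : Γ → M} [DFun a] [DFun b] : Dfn fun v => RatLe (a v) (b v) := by
  have h : Dfn fun v : M × M => RatLe v.1 v.2 := by
    unfold RatLe
    infer_instance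
  exact h.comp fun v => (a v, b v)

instance Dfn.ratLt {a b : Γ → M} [DFun a] [DFun b] : Dfn fun v => RatLt (a v) (b v) :=
  inferInstanceAs (Dfn fun v => IsRat (a v) ∧ IsRat (b v) ∧ ¬ RatLe (b v) (a v))

instance Dfn.ratAdd {a b c : Γ → M} [DFun a] [DFun b] [DFun c] :
    Dfn fun v => RatAdd (a v) (b v) (c v) := by
  have h : Dfn fun v : M × M × M => RatAdd v.1 v.2.1 v.2.2 := by
    unfold RatAdd
    infer_instance
  exact h.clo₃ _ a b c

instance Dfn.isReal' : Dfn fun v : M => IsReal v := by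
  unfold IsReal
  infer_instance

/-! ### The set of rational numbers -/

/-- For each `y` the row of pairs with first entry `y` is a set by replacement. Replacement collects
the rows, and their union is the product. -/
theorem exists_prod (a b : M) :
    ∃ c, ∀ x, x ∈ᴹ c ↔ ∃ y z, y ∈ᴹ a ∧ z ∈ᴹ b ∧ x = pr y z := by
  have h1 : ∀ y, ∃ c, ∀ x, x ∈ᴹ c ↔ ∃ z, z ∈ᴹ b ∧ x = pr y z := fun y =>
    exists_image b (fun z x => x = pr y z) (by rintro z - x x' rfl rfl; rfl)
  obtain ⟨d, hd⟩ := exists_image a (fun y c => ∀ x, x ∈ᴹ c ↔ ∃ z, z ∈ᴹ b ∧ x = pr y z) (by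
    rintro y - c c' h h'
    exact ext fun x => (h x).trans (h' x).symm)
  obtain ⟨c, hc⟩ := hM.out.union d
  refine ⟨c, fun x => (hc x).trans ?_⟩
  constructor
  · rintro ⟨e, he, hx⟩
    obtain ⟨y, hy, h⟩ := (hd e).1 he
    obtain ⟨z, hz, rfl⟩ := (h x).1 hx
    exact ⟨y, z, hy, hz, rfl⟩
  · rintro ⟨y, z, hy, hz, rfl⟩
    obtain ⟨e, he⟩ := h1 y
    exact ⟨e, (hd e).2 ⟨y, hy, he⟩, (he _).2 ⟨z, hz, rfl⟩⟩

/-- The formal fraction `(a - b) / c`. -/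
noncomputable def frac (a b c : N M) : M := pr (pr a.1 b.1) c.1

instance DFun.frac {a b c : Γ → N M} [DFun a] [DFun b] [DFun c] :
    DFun fun v => frac (a v) (b v) (c v) :=
  inferInstanceAs (DFun fun v => SetModel.pr (SetModel.pr (a v).1 (b v).1) (c v).1)

theorem frac_inj {a b c a' b' c' : N M} : frac a b c = frac a' b' c' ↔ a = a' ∧ b = b' ∧ c = c' := by
  simp [frac, pr_inj, Subtype.ext_iff, and_assoc]

theorem isFrac_iff {q a b c : M} :
    IsFrac q a b c ↔ ∃ a' b' c' : N M, a'.1 = a ∧ b'.1 = b ∧ c'.1 = c ∧ 0 < c' ∧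
      q = frac a' b' c' := by
  constructor
  · rintro ⟨ha, hb, hc, h0, p, hp, hq⟩
    refine ⟨⟨a, ha⟩, ⟨b, hb⟩, ⟨c, hc⟩, rfl, rfl, rfl, ?_, ?_⟩
    · refine lt_of_le_of_ne (N.zero_le _) fun h => h0 (isEmptySet_iff.2 ?_)
      exact (congrArg Subtype.val h).symm
    · rw [isPair_iff.1 hq, isPair_iff.1 hp, frac]
  · rintro ⟨a, b, c, rfl, rfl, rfl, h, rfl⟩
    exact ⟨a.2, b.2, c.2, fun h' => h.ne (Subtype.ext (isEmptySet_iff.1 h').symm), _,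
      isPair_pr _ _, isPair_pr _ _⟩

theorem isRat_iff {q : M} : IsRat q ↔ ∃ a b c : N M, 0 < c ∧ q = frac a b c := by
  constructor
  · rintro ⟨a, b, c, h⟩
    obtain ⟨a, b, c, -, -, -, h, h'⟩ := isFrac_iff.1 h
    exact ⟨a, b, c, h, h'⟩
  · rintro ⟨a, b, c, h, rfl⟩
    exact ⟨a.1, b.1, c.1, isFrac_iff.2 ⟨a, b, c, rfl, rfl, rfl, h, rfl⟩⟩

theorem isRat_frac {a b c : N M} (h : 0 < c) : IsRat (frac a b c) :=
  isRat_iff.2 ⟨a, b, c, h, rfl⟩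

instance IsSmall.isRat : IsSmall fun x : M => IsRat x := by
  obtain ⟨p, hp⟩ := exists_prod (omega M) (omega M)
  obtain ⟨q, hq⟩ := exists_prod p (omega M)
  refine ⟨sep q fun x => IsRat x, fun x => mem_sep.trans (and_iff_right_of_imp ?_)⟩
  intro h
  obtain ⟨a, b, c, -, rfl⟩ := isRat_iff.1 h
  exact (hq _).2 ⟨_, _, (hp _).2 ⟨_, _, mem_omega.2 a.2, mem_omega.2 b.2, rfl⟩,
    mem_omega.2 c.2, rfl⟩

theorem ratLe_iff {a b c a' b' c' : N M} (h : 0 < c) (h' : 0 < c') :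
    RatLe (frac a b c) (frac a' b' c') ↔ a * c' + b' * c ≤ a' * c + b * c' := by
  constructor
  · rintro ⟨x, y, z, x', y', z', s, t, h1, h2, h3, h4, h5⟩
    obtain ⟨x, y, z, rfl, rfl, rfl, -, e⟩ := isFrac_iff.1 h1
    obtain ⟨x', y', z', rfl, rfl, rfl, -, e'⟩ := isFrac_iff.1 h2
    obtain ⟨rfl, rfl, rfl⟩ := frac_inj.1 e
    obtain ⟨rfl, rfl, rfl⟩ := frac_inj.1 e'
    obtain rfl := natMulAddMul_iff.1 h3
    obtain rfl := natMulAddMul_iff.1 h4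
    exact h5
  · intro hle
    exact ⟨_, _, _, _, _, _, _, _, isFrac_iff.2 ⟨a, b, c, rfl, rfl, rfl, h, rfl⟩,
      isFrac_iff.2 ⟨a', b', c', rfl, rfl, rfl, h', rfl⟩, natMulAddMul_iff.2 rfl,
      natMulAddMul_iff.2 rfl, hle⟩

theorem ratLt_iff {a b c a' b' c' : N M} (h : 0 < c) (h' : 0 < c') :
    RatLt (frac a b c) (frac a' b' c') ↔ a * c' + b' * c < a' * c + b * c' := by
  rw [RatLt, ratLe_iff h' h, not_le]
  exact ⟨fun h => h.2.2, fun k => ⟨isRat_frac h, isRat_frac h', k⟩⟩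

theorem ratAdd_iff {a b c a' b' c' : N M} {t : M} (h : 0 < c) (h' : 0 < c') :
    RatAdd (frac a b c) (frac a' b' c') t ↔
      t = frac (a * c' + a' * c) (b * c' + b' * c) (c * c') := by
  constructor
  · rintro ⟨x, y, z, x', y', z', x'', y'', z'', h1, h2, h3, h4, h5, h6⟩
    obtain ⟨x, y, z, rfl, rfl, rfl, -, e⟩ := isFrac_iff.1 h1
    obtain ⟨x', y', z', rfl, rfl, rfl, -, e'⟩ := isFrac_iff.1 h2
    obtain ⟨x'', y'', z'', rfl, rfl, rfl, -, rfl⟩ := isFrac_iff.1 h3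
    obtain ⟨rfl, rfl, rfl⟩ := frac_inj.1 e
    obtain ⟨rfl, rfl, rfl⟩ := frac_inj.1 e'
    rw [Subtype.ext (natMulAddMul_iff.1 h4), Subtype.ext (natMulAddMul_iff.1 h5),
      Subtype.ext (natMul_iff.1 h6)]
  · rintro rfl
    exact ⟨_, _, _, _, _, _, _, _, _, isFrac_iff.2 ⟨a, b, c, rfl, rfl, rfl, h, rfl⟩,
      isFrac_iff.2 ⟨a', b', c', rfl, rfl, rfl, h', rfl⟩,
      isFrac_iff.2 ⟨_, _, _, rfl, rfl, rfl, mul_pos h h', rfl⟩,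
      natMulAddMul_iff.2 rfl, natMulAddMul_iff.2 rfl, natMul_iff.2 rfl⟩

omit hM in
theorem RatLe.isRat_left {p q : M} (h : RatLe p q) : IsRat p := by
  obtain ⟨_, _, _, _, _, _, _, _, h, -⟩ := h
  exact ⟨_, _, _, h⟩

omit hM in
theorem RatLe.isRat_right {p q : M} (h : RatLe p q) : IsRat q := by
  obtain ⟨_, _, _, _, _, _, _, _, -, h, -⟩ := h
  exact ⟨_, _, _, h⟩

theorem RatLe.total {p q : M} (hp : IsRat p) (hq : IsRat q) : RatLe p q ∨ RatLe q p := by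
  obtain ⟨a, b, c, h, rfl⟩ := isRat_iff.1 hp
  obtain ⟨a', b', c', h', rfl⟩ := isRat_iff.1 hq
  rw [ratLe_iff h h', ratLe_iff h' h]
  exact le_total _ _

theorem RatLe.refl {p : M} (hp : IsRat p) : RatLe p p := (RatLe.total hp hp).elim id id

theorem RatLe.trans {p q r : M} (h : RatLe p q) (h' : RatLe q r) : RatLe p r := by
  obtain ⟨a, b, c, hc, rfl⟩ := isRat_iff.1 h.isRat_left
  obtain ⟨a', b', c', hc', rfl⟩ := isRat_iff.1 h.isRat_right
  obtain ⟨a'', b'', c'', hc'', rfl⟩ := isRat_iff.1 h'.isRat_right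
  rw [ratLe_iff hc hc'] at h
  rw [ratLe_iff hc' hc''] at h'
  rw [ratLe_iff hc hc'']
  -- Natural numbers cannot be subtracted, so the terms of the middle fraction are added to both
  -- sides. The goal, multiplied by `c'`, is then a combination of the two hypotheses.
  refine le_of_mul_le_mul_left (le_of_add_le_add_right (a := a' * c * c'' + b' * c * c'') ?_) hc'
  calc c' * (a * c'' + b'' * c) + (a' * c * c'' + b' * c * c'')
      = c'' * (a * c' + b' * c) + c * (a' * c'' + b'' * c') := by ring
    _ ≤ c'' * (a' * c + b * c') + c * (a'' * c' + b' * c'') := by gcongr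
    _ = _ := by ring

theorem RatLt.le {p q : M} (h : RatLt p q) : RatLe p q :=
  (RatLe.total h.1 h.2.1).resolve_right h.2.2

theorem RatLe.trans_lt {p q r : M} (h : RatLe p q) (h' : RatLt q r) : RatLt p r :=
  ⟨h.isRat_left, h'.2.1, fun k => h'.2.2 (k.trans h)⟩

theorem RatLt.trans_le {p q r : M} (h : RatLt p q) (h' : RatLe q r) : RatLt p r :=
  ⟨h.1, h'.isRat_right, fun k => h.2.2 (h'.trans k)⟩

theorem exists_ratAdd {p q : M} (hp : IsRat p) (hq : IsRat q) : ∃ t, RatAdd p q t := by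
  obtain ⟨a, b, c, hc, rfl⟩ := isRat_iff.1 hp
  obtain ⟨a', b', c', hc', rfl⟩ := isRat_iff.1 hq
  exact ⟨_, (ratAdd_iff hc hc').2 rfl⟩

omit hM in
theorem RatAdd.isRat {p q t : M} (h : RatAdd p q t) : IsRat p ∧ IsRat q ∧ IsRat t := by
  obtain ⟨_, _, _, _, _, _, _, _, _, h1, h2, h3, -⟩ := h
  exact ⟨⟨_, _, _, h1⟩, ⟨_, _, _, h2⟩, _, _, _, h3⟩

theorem RatAdd.lt {p q t p' q' t' : M} (h : RatAdd p q t) (h' : RatAdd p' q' t')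
    (hp : RatLt p p') (hq : RatLe q q') : RatLt t t' := by
  obtain ⟨a, b, c, hc, rfl⟩ := isRat_iff.1 h.isRat.1
  obtain ⟨a', b', c', hc', rfl⟩ := isRat_iff.1 h.isRat.2.1
  obtain ⟨d, e, f, hf, rfl⟩ := isRat_iff.1 h'.isRat.1
  obtain ⟨d', e', f', hf', rfl⟩ := isRat_iff.1 h'.isRat.2.1
  obtain rfl := (ratAdd_iff hc hc').1 h
  obtain rfl := (ratAdd_iff hf hf').1 h'
  rw [ratLt_iff hc hf] at hp
  rw [ratLe_iff hc' hf'] at hq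
  rw [ratLt_iff (mul_pos hc hc') (mul_pos hf hf')]
  calc _ = (a * f + e * c) * (c' * f') + (a' * f' + e' * c') * (c * f) := by ring
    _ < (d * c + b * f) * (c' * f') + (d' * c' + b' * f') * (c * f) :=
      add_lt_add_of_lt_of_le (mul_lt_mul_of_pos_right hp (mul_pos hc' hf'))
        (mul_le_mul_of_nonneg_right hq (mul_pos hc hf).le)
    _ = _ := by ring

theorem exists_ratLt_between_inv {q : M} {n : N M} (hn : 0 < n) (h : RatLt q (frac 1 0 n)) :
    ∃ p, RatLt q p ∧ RatLt p (frac 1 0 n) := by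
  obtain ⟨a, b, c, hc, rfl⟩ := isRat_iff.1 h.1
  rw [ratLt_iff hc hn, zero_mul, add_zero, one_mul] at h
  have h2 : (0 : N M) < 2 * c * n := mul_pos (mul_pos two_pos hc) hn
  -- The midpoint of `(a - b) / c` and `1 / n`.
  refine ⟨frac (a * n + c) (b * n) (2 * c * n), ?_, ?_⟩
  · rw [ratLt_iff hc h2]
    calc _ = (a * n) * c + (a * n * c + b * n * c) := by ring
      _ < (c + b * n) * c + (a * n * c + b * n * c) :=
        add_lt_add_left (mul_lt_mul_of_pos_right h hc) _
      _ = _ := by ring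
  · rw [ratLt_iff h2 hn]
    calc _ = (a * n) * n + c * n := by ring
      _ < (c + b * n) * n + c * n := add_lt_add_left (mul_lt_mul_of_pos_right h hn) _
      _ = _ := by ring

theorem ratLt_inv_of_add {p q t : M} {n : N M} (hn : 0 < n) (h : RatAdd p q t)
    (hp : RatLt p (frac 1 0 (2 * n))) (hq : RatLt q (frac 1 0 (2 * n))) :
    RatLt t (frac 1 0 n) := by
  obtain ⟨a, b, c, hc, rfl⟩ := isRat_iff.1 h.isRat.1
  obtain ⟨a', b', c', hc', rfl⟩ := isRat_iff.1 h.isRat.2.1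
  obtain rfl := (ratAdd_iff hc hc').1 h
  rw [ratLt_iff hc (mul_pos two_pos hn), zero_mul, add_zero, one_mul] at hp
  rw [ratLt_iff hc' (mul_pos two_pos hn), zero_mul, add_zero, one_mul] at hq
  rw [ratLt_iff (mul_pos hc hc') hn, zero_mul, add_zero, one_mul]
  refine lt_of_mul_lt_mul_left ?_ (two_pos (α := N M)).le
  calc _ = a * (2 * n) * c' + a' * (2 * n) * c := by ring
    _ < (c + b * (2 * n)) * c' + (c' + b' * (2 * n)) * c :=
      add_lt_add (mul_lt_mul_of_pos_right hp hc') (mul_lt_mul_of_pos_right hq hc)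
    _ = _ := by ring

/-! ### Real numbers -/

variable (M) in
/-- The real numbers of the model `M`. -/
abbrev R : Type u := {r : M // IsReal r}

instance : LE (R M) := ⟨fun r s => Sub r.1 s.1⟩

omit hM in
theorem R.le_def {r s : R M} : r ≤ s ↔ ∀ q, q ∈ᴹ r.1 → q ∈ᴹ s.1 := Iff.rfl

omit hM in
theorem R.lt_of_mem {r : R M} {p q : M} (hq : IsRat q) (hr : ¬ q ∈ᴹ r.1) (hp : p ∈ᴹ r.1) :
    RatLt p q :=
  ⟨r.2.1 p hp, hq, fun h => hr (r.2.2.2.2.1 p q hp h)⟩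

noncomputable instance : LinearOrder (R M) where
  le_refl r := fun _ h => h
  le_trans r s t h h' := fun q hq => h' q (h q hq)
  le_antisymm r s h h' := Subtype.ext (Sub.antisymm h h')
  le_total r s := by
    by_contra hc
    simp only [R.le_def] at hc
    push Not at hc
    obtain ⟨⟨q, hq, hqs⟩, p, hp, hpr⟩ := hc
    exact (R.lt_of_mem (r.2.1 q hq) hqs hp).2.2 (R.lt_of_mem (s.2.1 p hp) hpr hq).le
  toDecidableLE := Classical.decRel _

theorem R.lt_iff {r s : R M} : r < s ↔ RealLt r.1 s.1 := by
  rw [lt_iff_le_and_ne]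
  exact and_congr_right fun _ => not_congr Subtype.ext_iff

instance Dfn.rle {f g : Γ → R M} [DFun f] [DFun g] : Dfn fun v => f v ≤ g v :=
  inferInstanceAs (Dfn fun v => Sub (f v).1 (g v).1)

instance Dfn.rlt {f g : Γ → R M} [DFun f] [DFun g] : Dfn fun v => f v < g v :=
  (inferInstance : Dfn fun v => f v ≤ g v ∧ ¬ g v ≤ f v).congr fun _ => lt_iff_le_not_ge

variable (M) in
theorem exists_ratSet : ∃ s : M, ∀ x, x ∈ᴹ s ↔ IsRat x := IsSmall.isRat.ex

variable (M) in
/-- The set of all formal fractions. -/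
noncomputable def ratSet : M := (exists_ratSet M).choose

theorem mem_ratSet {x : M} : x ∈ᴹ ratSet M ↔ IsRat x := (exists_ratSet M).choose_spec x

variable (M) in
theorem exists_zero : ∃ z : M, IsZero z ∧ IsReal z := by
  have h : ∀ q : M, q ∈ᴹ sep (ratSet M) (fun q => ∃ a b c, IsFrac q a b c ∧ a ∈ᴹ b) ↔
      ∃ a b c, IsFrac q a b c ∧ a ∈ᴹ b := by
    intro q
    refine mem_sep.trans (and_iff_right_of_imp ?_)
    rintro ⟨a, b, c, h, -⟩
    exact mem_ratSet.2 ⟨a, b, c, h⟩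
  have h' : ∀ {a b c : N M}, 0 < c → (frac a b c ∈ᴹ
      sep (ratSet M) (fun q => ∃ a b c, IsFrac q a b c ∧ a ∈ᴹ b) ↔ a < b) := by
    intro a b c hc
    rw [h]
    constructor
    · rintro ⟨x, y, z, hq, hxy⟩
      obtain ⟨x, y, z, rfl, rfl, rfl, -, e⟩ := isFrac_iff.1 hq
      obtain ⟨rfl, rfl, rfl⟩ := frac_inj.1 e
      exact hxy
    · exact fun hab => ⟨_, _, _, isFrac_iff.2 ⟨a, b, c, rfl, rfl, rfl, hc, rfl⟩, hab⟩
  refine ⟨_, h, fun q hq => mem_ratSet.1 (mem_sep.1 hq).1, ⟨frac 0 1 1, (h' one_pos).2 one_pos⟩,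
    ⟨frac 0 0 1, isRat_frac one_pos, fun h0 => ((h' one_pos).1 h0).ne rfl⟩, ?_, ?_⟩
  · intro q p hq hpq
    obtain ⟨a, b, c, hc, rfl⟩ := isRat_iff.1 hpq.isRat_right
    obtain ⟨a', b', c', hc', rfl⟩ := isRat_iff.1 hpq.isRat_left
    rw [h' hc] at hq
    rw [ratLe_iff hc' hc] at hpq
    rw [h' hc']
    by_contra hlt
    refine hpq.not_gt ?_
    rw [add_comm (a' * c)]
    exact add_lt_add_of_lt_of_le (mul_lt_mul_of_pos_right hq hc')
      (mul_le_mul_of_nonneg_right (not_lt.1 hlt) hc.le)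
  · intro q hq
    obtain ⟨a, b, c, hc, rfl⟩ := isRat_iff.1 (mem_ratSet.1 (mem_sep.1 hq).1)
    rw [h' hc] at hq
    have h2 : 0 < 2 * c := mul_pos two_pos hc
    -- Halving a negative rational makes it larger, so the cut has no greatest element.
    refine ⟨frac a b (2 * c), (h' h2).2 hq, (ratLt_iff hc h2).2 ?_⟩
    calc _ = a * c + (a * c + b * c) := by ring
      _ < b * c + (a * c + b * c) := add_lt_add_left (mul_lt_mul_of_pos_right hq hc) _
      _ = _ := by ring

noncomputable instance : Zero (R M) := ⟨⟨(exists_zero M).choose, (exists_zero M).choose_spec.2⟩⟩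

theorem isZero_iff {z : M} : IsZero z ↔ z = (0 : R M).1 := by
  have h : IsZero (0 : R M).1 := (exists_zero M).choose_spec.1
  exact ⟨fun h' => ext fun q => (h' q).trans (h q).symm, by rintro rfl; exact h⟩

theorem isNonneg_iff {r : M} : IsNonneg r ↔ ∃ x : R M, 0 ≤ x ∧ x.1 = r := by
  constructor
  · rintro ⟨h, z, hz, hr⟩
    obtain rfl := isZero_iff.1 hz
    exact ⟨⟨r, h⟩, hr, rfl⟩
  · rintro ⟨x, hx, rfl⟩
    exact ⟨x.2, _, isZero_iff.2 rfl, hx⟩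

theorem isPos_iff {r : M} : IsPos r ↔ ∃ x : R M, 0 < x ∧ x.1 = r := by
  constructor
  · rintro ⟨h, z, hz, hr⟩
    obtain rfl := isZero_iff.1 hz
    exact ⟨⟨r, h⟩, R.lt_iff.2 hr, rfl⟩
  · rintro ⟨x, hx, rfl⟩
    exact ⟨x.2, _, isZero_iff.2 rfl, R.lt_iff.1 hx⟩

theorem frac_mem_zero {a b c : N M} (hc : 0 < c) : frac a b c ∈ᴹ (0 : R M).1 ↔ a < b := by
  refine (isZero_iff.2 rfl _).trans ?_
  constructor
  · rintro ⟨x, y, z, hq, hxy⟩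
    obtain ⟨x, y, z, rfl, rfl, rfl, -, e⟩ := isFrac_iff.1 hq
    obtain ⟨rfl, rfl, rfl⟩ := frac_inj.1 e
    exact hxy
  · exact fun hab => ⟨_, _, _, isFrac_iff.2 ⟨a, b, c, rfl, rfl, rfl, hc, rfl⟩, hab⟩

theorem N.add_one_pos (n : N M) : 0 < n + 1 := N.lt_add_one_iff.2 (N.zero_le n)

theorem ratLt_inv_iff {a b c n : N M} (hc : 0 < c) (hn : 0 < n) :
    RatLt (frac a b c) (frac 1 0 n) ↔ a * n < c + b * n := by
  rw [ratLt_iff hc hn, zero_mul, add_zero, one_mul]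

/-- The real number `1 / (n + 1)`. -/
noncomputable def rho (n : N M) : R M :=
  ⟨sep (ratSet M) fun q => RatLt q (frac 1 0 (n + 1)), by
    have hn := N.add_one_pos n
    have h : ∀ q : M, q ∈ᴹ sep (ratSet M) (fun q => RatLt q (frac 1 0 (n + 1))) ↔
        RatLt q (frac 1 0 (n + 1)) := fun q =>
      mem_sep.trans (and_iff_right_of_imp fun h => mem_ratSet.2 h.1)
    refine ⟨fun q hq => ((h q).1 hq).1, ⟨frac 0 0 1, (h _).2 ?_⟩, ⟨frac 1 0 (n + 1),
      isRat_frac hn, fun h' => ((h _).1 h').2.2 (RatLe.refl (isRat_frac hn))⟩, ?_, ?_⟩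
    · rw [ratLt_inv_iff one_pos hn]
      simp
    · exact fun q p hq hpq => (h p).2 (hpq.trans_lt ((h q).1 hq))
    · intro q hq
      obtain ⟨p, hp, hp'⟩ := exists_ratLt_between_inv hn ((h q).1 hq)
      exact ⟨p, (h p).2 hp', hp⟩⟩

theorem mem_rho {n : N M} {q : M} : q ∈ᴹ (rho n).1 ↔ RatLt q (frac 1 0 (n + 1)) :=
  mem_sep.trans (and_iff_right_of_imp fun h => mem_ratSet.2 h.1)

instance DFun.rho {f : Γ → N M} [DFun f] : DFun fun v => rho (f v) := by
  have h : DFun fun v : N M => SetModel.rho v := by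
    refine DFun.of_graph (R := fun v y => ∀ q, q ∈ᴹ y.1 ↔ RatLt q (SetModel.frac 1 0 (v + 1)))
      inferInstance ?_
    intro v y
    exact ⟨fun h => Subtype.ext (ext fun q => mem_rho.trans (h q).symm),
      by rintro rfl q; exact mem_rho⟩
  exact h.comp f

theorem rho_pos (n : N M) : 0 < rho n := by
  rw [← not_le]
  intro h
  refine ((frac_mem_zero one_pos).1 (h (frac 0 0 1) (mem_rho.2 ?_))).ne rfl
  rw [ratLt_inv_iff one_pos (N.add_one_pos n)]
  simp

theorem rho_anti {m n : N M} (h : m ≤ n) : rho n ≤ rho m := by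
  intro q hq
  refine mem_rho.2 ((mem_rho.1 hq).trans_le ?_)
  rw [ratLe_iff (N.add_one_pos n) (N.add_one_pos m)]
  simpa using h

/-- The cut `ε` contains a rational that is not negative and above it a positive one, which is at
least the reciprocal of its denominator `n + 1`. That reciprocal lies in `ε` but not in `rho n`. -/
theorem exists_rho_lt {ε : R M} (hε : 0 < ε) : ∃ n, rho n < ε := by
  obtain ⟨q, hq, hq0⟩ : ∃ q, q ∈ᴹ ε.1 ∧ ¬ q ∈ᴹ (0 : R M).1 := by
    by_contra h
    push Not at h
    exact hε.not_ge h
  obtain ⟨p, hp, hqp⟩ := ε.2.2.2.2.2 q hq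
  obtain ⟨a, b, c, hc, rfl⟩ := isRat_iff.1 hqp.1
  obtain ⟨a', b', c', hc', rfl⟩ := isRat_iff.1 hqp.2.1
  rw [frac_mem_zero hc, not_lt] at hq0
  rw [ratLt_iff hc hc'] at hqp
  have hab : b' < a' := by
    by_contra h
    refine hqp.not_ge ?_
    rw [add_comm (a' * c)]
    exact add_le_add (mul_le_mul_of_nonneg_right hq0 hc'.le)
      (mul_le_mul_of_nonneg_right (not_lt.1 h) hc.le)
  obtain ⟨n, rfl⟩ := N.exists_succ hc'.ne'
  rw [N.succ_eq] at hp hc'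
  have hn : frac 1 0 (n + 1) ∈ᴹ ε.1 := by
    refine ε.2.2.2.2.1 _ _ hp ?_
    rw [ratLe_iff hc' hc', ← add_mul, zero_mul, add_zero]
    refine mul_le_mul_of_nonneg_right ?_ hc'.le
    rw [add_comm]
    exact N.add_one_le_iff.2 hab
  refine ⟨n, not_le.1 fun h => ?_⟩
  exact (mem_rho.1 (h _ hn)).2.2 (RatLe.refl (isRat_frac hc'))

/-! ### Addition of real numbers -/

/-- The sum of two rationals outside the cuts lies outside the sum, so it is proper. Enlarging one
summand within its cut shows that there is no greatest element. -/
theorem exists_realAdd (r s : R M) : ∃ t : R M, RealAdd r.1 s.1 t.1 := by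
  have h : ∀ q : M, q ∈ᴹ sep (ratSet M) (fun q => ∃ p p' v, p ∈ᴹ r.1 ∧ p' ∈ᴹ s.1 ∧
      RatAdd p p' v ∧ RatLe q v) ↔ ∃ p p' v, p ∈ᴹ r.1 ∧ p' ∈ᴹ s.1 ∧ RatAdd p p' v ∧ RatLe q v := by
    intro q
    refine mem_sep.trans (and_iff_right_of_imp ?_)
    rintro ⟨_, _, _, -, -, -, h⟩
    exact mem_ratSet.2 h.isRat_left
  refine ⟨⟨_, fun q hq => mem_ratSet.1 (mem_sep.1 hq).1, ?_, ?_, ?_, ?_⟩, h⟩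
  · obtain ⟨p, hp⟩ := r.2.2.1
    obtain ⟨p', hp'⟩ := s.2.2.1
    obtain ⟨v, hv⟩ := exists_ratAdd (r.2.1 p hp) (s.2.1 p' hp')
    exact ⟨v, (h v).2 ⟨p, p', v, hp, hp', hv, RatLe.refl hv.isRat.2.2⟩⟩
  · obtain ⟨p, hp, hpr⟩ := r.2.2.2.1
    obtain ⟨p', hp', hps⟩ := s.2.2.2.1
    obtain ⟨v, hv⟩ := exists_ratAdd hp hp'
    refine ⟨v, hv.isRat.2.2, fun hc => ?_⟩
    obtain ⟨a, b, w, ha, hb, hw, hle⟩ := (h v).1 hc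
    exact (hw.lt hv (R.lt_of_mem hp hpr ha) (R.lt_of_mem hp' hps hb).le).2.2 hle
  · intro q p hq hpq
    obtain ⟨a, b, w, ha, hb, hw, hle⟩ := (h q).1 hq
    exact (h p).2 ⟨a, b, w, ha, hb, hw, hpq.trans hle⟩
  · intro q hq
    obtain ⟨a, b, w, ha, hb, hw, hle⟩ := (h q).1 hq
    obtain ⟨a', ha', haa'⟩ := r.2.2.2.2.2 a ha
    obtain ⟨v, hv⟩ := exists_ratAdd haa'.2.1 (s.2.1 b hb)
    exact ⟨v, (h v).2 ⟨a', b, v, ha', hb, hv, RatLe.refl hv.isRat.2.2⟩,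
      hle.trans_lt (hw.lt hv haa' (RatLe.refl (s.2.1 b hb)))⟩

/-- Addition of real numbers. -/
noncomputable def radd (r s : R M) : R M := (exists_realAdd r s).choose

theorem realAdd_radd (r s : R M) : RealAdd r.1 s.1 (radd r s).1 := (exists_realAdd r s).choose_spec

theorem radd_le_radd {r s r' s' : R M} (h : r ≤ r') (h' : s ≤ s') : radd r s ≤ radd r' s' := by
  intro q hq
  obtain ⟨a, b, w, ha, hb, hw⟩ := (realAdd_radd r s q).1 hq
  exact (realAdd_radd r' s' q).2 ⟨a, b, w, h a ha, h' b hb, hw⟩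

/-- A substitute for `ε / 2`. Together with `mdist_lt_of_half` it carries the `ε` arguments without
any field structure on `R M`. -/
theorem exists_half {ε : R M} (hε : 0 < ε) : ∃ η : R M, 0 < η ∧ η < ε ∧ radd η η < ε := by
  obtain ⟨n, hn⟩ := exists_rho_lt hε
  -- This number is `1 / (2 * n + 2)`, half of `rho n`.
  refine ⟨rho (2 * n + 1), rho_pos _, (rho_anti ?_).trans_lt hn, lt_of_le_of_lt ?_ hn⟩
  · calc n ≤ n + n := le_add_of_nonneg_left (N.zero_le n)
      _ ≤ n + n + 1 := le_add_of_nonneg_right (N.zero_le 1)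
      _ = 2 * n + 1 := by ring
  · intro q hq
    obtain ⟨a, b, w, ha, hb, hw, hle⟩ := (realAdd_radd _ _ q).1 hq
    have e : 2 * n + 1 + 1 = 2 * (n + 1) := by ring
    rw [mem_rho, e] at ha hb
    exact mem_rho.2 (hle.trans_lt (ratLt_inv_of_add (N.add_one_pos n) hw ha hb))

/-! ### Suprema -/

/-- The supremum is the union of the cuts; a rational outside `K` shows that it is proper. -/
theorem R.exists_isLUB {P : R M → Prop} [hd : Dfn P] (hP : ∃ x, P x) {K : R M}
    (hK : ∀ x, P x → x ≤ K) : ∃ s : R M, (∀ x, P x → x ≤ s) ∧ ∀ t : R M, (∀ x, P x → x ≤ t) → s ≤ t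
    := by
  have := Dfn.clo₁ hd
  obtain ⟨c, h⟩ : ∃ c : M, ∀ q, q ∈ᴹ c ↔ ∃ x : R M, P x ∧ q ∈ᴹ x.1 := by
    refine ⟨sep (ratSet M) fun q => ∃ x : R M, P x ∧ q ∈ᴹ x.1, fun q =>
      mem_sep.trans (and_iff_right_of_imp ?_)⟩
    rintro ⟨x, -, hq⟩
    exact mem_ratSet.2 (x.2.1 q hq)
  refine ⟨⟨c, fun q hq => ?_, ?_, ?_, ?_, ?_⟩, ?_, ?_⟩
  · obtain ⟨x, -, hqx⟩ := (h q).1 hq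
    exact x.2.1 q hqx
  · obtain ⟨x, hx⟩ := hP
    obtain ⟨q, hq⟩ := x.2.2.1
    exact ⟨q, (h q).2 ⟨x, hx, hq⟩⟩
  · obtain ⟨q, hq, hqK⟩ := K.2.2.2.1
    refine ⟨q, hq, fun hc => ?_⟩
    obtain ⟨x, hx, hqx⟩ := (h q).1 hc
    exact hqK (hK x hx q hqx)
  · intro q p hq hpq
    obtain ⟨x, hx, hqx⟩ := (h q).1 hq
    exact (h p).2 ⟨x, hx, x.2.2.2.2.1 q p hqx hpq⟩
  · intro q hq
    obtain ⟨x, hx, hqx⟩ := (h q).1 hq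
    obtain ⟨p, hp, hqp⟩ := x.2.2.2.2.2 q hqx
    exact ⟨p, (h p).2 ⟨x, hx, hp⟩, hqp⟩
  · exact fun x hx q hq => (h q).2 ⟨x, hx, hq⟩
  · intro t ht q hq
    obtain ⟨x, hx, hqx⟩ := (h q).1 hq
    exact ht x hx q hqx

/-! ### Metric spaces -/

/-- The type of the elements of a set. -/
abbrev El (X : M) : Type u := {x : M // x ∈ᴹ X}

section Metric

variable {X d : M}

/-- The distance function of a metric space. -/
noncomputable def mdist (hd : IsMetric X d) (x y : El X) : R M :=
  Mp.ev ⟨d, hd.1⟩ ⟨pr x.1 y.1, x.1, y.1, x.2, y.2, isPair_pr _ _⟩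

theorem dist_iff (hd : IsMetric X d) {x y : El X} {r : M} :
    Dist d x.1 y.1 r ↔ r = (mdist hd x y).1 := by
  refine Iff.trans ?_ (Mp.app_iff (f := ⟨d, hd.1⟩)
    (a := ⟨pr x.1 y.1, x.1, y.1, x.2, y.2, isPair_pr _ _⟩))
  simp [Dist, isPair_iff]

theorem dist_mdist (hd : IsMetric X d) (x y : El X) : Dist d x.1 y.1 (mdist hd x y).1 :=
  (dist_iff hd).2 rfl

instance DFun.mdist (hd : IsMetric X d) {f g : Γ → El X} [DFun f] [DFun g] :
    DFun fun v => mdist hd (f v) (g v) := by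
  have h : DFun fun v : El X × El X => SetModel.mdist hd v.1 v.2 := by
    refine DFun.of_graph (R := fun v y => SetModel.pr (SetModel.pr v.1.1 v.2.1) y.1 ∈ᴹ d) inferInstance ?_
    intro v y
    rw [← app_iff, eq_comm, Subtype.ext_iff, ← dist_iff hd]
    simp [Dist, isPair_iff]
  exact h.clo₂ _ f g

theorem distLt_iff (hd : IsMetric X d) {x y : El X} {r : R M} :
    DistLt d x.1 y.1 r.1 ↔ mdist hd x y < r := by
  simp only [DistLt, dist_iff hd, exists_eq_left, R.lt_iff]

theorem mdist_eq_zero (hd : IsMetric X d) {x y : El X} : mdist hd x y = 0 ↔ x = y := by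
  rw [Subtype.ext_iff, ← isZero_iff, Subtype.ext_iff]
  exact hd.2.2.1 _ _ _ (dist_mdist hd x y)

theorem mdist_self (hd : IsMetric X d) (x : El X) : mdist hd x x = 0 := (mdist_eq_zero hd).2 rfl

theorem mdist_nonneg (hd : IsMetric X d) (x y : El X) : 0 ≤ mdist hd x y := by
  obtain ⟨r, hr, h⟩ := isNonneg_iff.1 (hd.2.1 _ _ _ (dist_mdist hd x y))
  rwa [Subtype.ext h] at hr

theorem mdist_comm (hd : IsMetric X d) (x y : El X) : mdist hd x y = mdist hd y x :=
  Subtype.ext ((dist_iff hd).1 (hd.2.2.2.1 _ _ _ (dist_mdist hd x y))).symm |>.symm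

theorem mdist_triangle (hd : IsMetric X d) (x y z : El X) :
    mdist hd x z ≤ radd (mdist hd x y) (mdist hd y z) :=
  hd.2.2.2.2 _ _ _ _ _ _ _ (dist_mdist hd x y) (dist_mdist hd y z) (dist_mdist hd x z)
    (realAdd_radd _ _)

theorem mdist_lt_of_half (hd : IsMetric X d) {x z : El X} (y : El X) {ε η : R M}
    (h : radd η η < ε) (h1 : mdist hd x y ≤ η) (h2 : mdist hd y z ≤ η) : mdist hd x z < ε :=
  ((mdist_triangle hd x y z).trans (radd_le_radd h1 h2)).trans_lt h

theorem mdist_eq_of_forall (hd : IsMetric X d) {x y : El X}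
    (h : ∀ ε : R M, 0 < ε → mdist hd x y < ε) : x = y := by
  rw [← mdist_eq_zero hd]
  by_contra hc
  exact (h _ (lt_of_le_of_ne (mdist_nonneg hd x y) (Ne.symm hc))).ne rfl

end Metric

/-! ### Sequences -/

/-- Sequences that are elements of `M` and definable maps on `N M` amount to the same thing, by
evaluation in one direction and `exists_map` in the other. From here on no sequence has to be
handled as a set of pairs. -/
theorem seqsHaveConvSubseq_iff {A B : M → Prop} [Dfn fun x => A x] {dist : M → M → M → Prop} :
    SeqsHaveConvSubseq A B dist ↔ ∀ s : N M → {a // A a}, DFun s → ∃ k : N M → N M, DFun k ∧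
      (∀ i j, i < j → k i < k j) ∧ ∃ l, B l ∧ ∀ ε : R M, 0 < ε → ∃ n₀, ∀ n, n₀ ≤ n →
        ∃ r, dist (s (k n)).1 l r ∧ RealLt r ε.1 := by
  constructor
  · intro h s hs
    obtain ⟨s', hs'⟩ := exists_map (A := fun x => IsNat x) (B := fun x => A x) s
    obtain ⟨k, hk, hmono, l, hl, hlim⟩ := h s'.1 s'.2
    let k' : Mp (M := M) (fun x => IsNat x) fun x => IsNat x := ⟨k, hk⟩
    refine ⟨fun n => k'.ev n, inferInstance, ?_, l, hl, ?_⟩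
    · exact fun i j hij => hmono _ _ _ _ hij (k'.app_ev i) (k'.app_ev j)
    · intro ε hε
      obtain ⟨n₀, hn₀, h⟩ := hlim ε.1 (isPos_iff.2 ⟨ε, hε, rfl⟩)
      refine ⟨⟨n₀, hn₀⟩, fun n hn => h n.1 _ n.2 hn ⟨_, k'.app_ev n, ?_⟩⟩
      rw [← hs']
      exact s'.app_ev _
  · intro h s hs
    let s' : Mp (fun x => IsNat x) (fun x => A x) := ⟨s, hs⟩
    obtain ⟨k, hk, hmono, l, hl, hlim⟩ := h (fun n => s'.ev n) inferInstance
    obtain ⟨k', hk'⟩ := exists_map (A := fun x => IsNat x) (B := fun x : M => IsNat x) k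
    refine ⟨k'.1, k'.2, ?_, l, hl, ?_⟩
    · intro i j v w hij hv hw
      obtain ⟨hi, rfl⟩ := Mp.app_iff'.1 hv
      obtain ⟨hj, rfl⟩ := Mp.app_iff'.1 hw
      rw [hk', hk']
      exact hmono _ _ hij
    · intro ε hε
      obtain ⟨ε, hε', rfl⟩ := isPos_iff.1 hε
      obtain ⟨n₀, h⟩ := hlim ε hε'
      refine ⟨n₀.1, n₀.2, ?_⟩
      rintro n a hn hle ⟨i, hi, ha⟩
      obtain ⟨hn, rfl⟩ := Mp.app_iff'.1 hi
      obtain ⟨hi, rfl⟩ := (Mp.app_iff' (f := s')).1 ha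
      rw [Subtype.coe_eta, hk']
      exact h ⟨n, hn⟩ hle

/-! ### Spaces of continuous functions -/

section Functions

variable {X dX Y dY : M}

theorem isContBdd_iff (hX : IsMetric X dX) (hY : IsMetric Y dY)
    {f : Mp (fun x => x ∈ᴹ X) fun y => y ∈ᴹ Y} :
    IsContBdd X dX Y dY f.1 ↔
      (∀ (x : El X) (ε : R M), 0 < ε → ∃ δ : R M, 0 < δ ∧ ∀ x' : El X, mdist hX x x' < δ →
        mdist hY (f.ev x) (f.ev x') < ε) ∧
      ∃ K : R M, ∀ x x' : El X, mdist hY (f.ev x) (f.ev x') ≤ K := by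
  refine (and_iff_right f.2).trans (and_congr ?_ ?_)
  · constructor
    · intro h x ε hε
      obtain ⟨δ, hδ, h⟩ := h x.1 ε.1 x.2 (isPos_iff.2 ⟨ε, hε, rfl⟩)
      obtain ⟨δ, hδ', rfl⟩ := isPos_iff.1 hδ
      exact ⟨δ, hδ', fun x' hx' => (distLt_iff hY).1
        (h x'.1 x'.2 ((distLt_iff hX).2 hx') _ _ (f.app_ev x) (f.app_ev x'))⟩
    · intro h x ε hx hε
      obtain ⟨ε, hε', rfl⟩ := isPos_iff.1 hε
      obtain ⟨δ, hδ, h⟩ := h ⟨x, hx⟩ ε hε'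
      refine ⟨δ.1, isPos_iff.2 ⟨δ, hδ, rfl⟩, fun x' hx' hd y y' hy hy' => ?_⟩
      obtain ⟨_, rfl⟩ := Mp.app_iff'.1 hy
      obtain ⟨_, rfl⟩ := Mp.app_iff'.1 hy'
      exact (distLt_iff hY).2 (h ⟨x', hx'⟩ ((distLt_iff hX).1 hd))
  · constructor
    · rintro ⟨K, hK, h⟩
      exact ⟨⟨K, hK⟩, fun x x' => h _ _ _ _ _ (f.app_ev x) (f.app_ev x') (dist_mdist hY _ _)⟩
    · rintro ⟨K, h⟩
      refine ⟨K.1, K.2, fun x x' y y' r hy hy' hr => ?_⟩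
      obtain ⟨_, rfl⟩ := Mp.app_iff'.1 hy
      obtain ⟨_, rfl⟩ := Mp.app_iff'.1 hy'
      obtain rfl := (dist_iff hY).1 hr
      exact h _ _

theorem isUnifBound_iff (hY : IsMetric Y dY) {f g : Mp (fun x => x ∈ᴹ X) fun y => y ∈ᴹ Y}
    {r : M} : IsUnifBound X dY f.1 g.1 r ↔
      ∃ t : R M, 0 ≤ t ∧ t.1 = r ∧ ∀ x, mdist hY (f.ev x) (g.ev x) ≤ t := by
  constructor
  · rintro ⟨hr, h⟩
    obtain ⟨t, ht, rfl⟩ := isNonneg_iff.1 hr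
    exact ⟨t, ht, rfl, fun x => h _ _ _ _ x.2 (f.app_ev x) (g.app_ev x) (dist_mdist hY _ _)⟩
  · rintro ⟨t, ht, rfl, h⟩
    refine ⟨isNonneg_iff.2 ⟨t, ht, rfl⟩, fun x y y' s hx hy hy' hs => ?_⟩
    obtain ⟨_, rfl⟩ := Mp.app_iff'.1 hy
    obtain ⟨_, rfl⟩ := Mp.app_iff'.1 hy'
    obtain rfl := (dist_iff hY).1 hs
    exact h _

theorem SupDist.mdist_le (hY : IsMetric Y dY) {f g : Mp (fun x => x ∈ᴹ X) fun y => y ∈ᴹ Y}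
    {r : M} {ε : R M} (h : SupDist X dY f.1 g.1 r) (hr : RealLt r ε.1) (x : El X) :
    mdist hY (f.ev x) (g.ev x) < ε := by
  obtain ⟨t, ht, rfl, h'⟩ := (isUnifBound_iff hY).1 h.1
  exact (h' x).trans_lt (R.lt_iff.2 hr)

theorem exists_supDist (hY : IsMetric Y dY) {f g : Mp (fun x => x ∈ᴹ X) fun y => y ∈ᴹ Y}
    {η : R M} (hη : 0 ≤ η) (h : ∀ x, mdist hY (f.ev x) (g.ev x) ≤ η) :
    ∃ t : R M, SupDist X dY f.1 g.1 t.1 ∧ t ≤ η := by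
  obtain ⟨t, ht, ht'⟩ := R.exists_isLUB
    -- Adjoining `0` keeps the set of distances nonempty when `X` is empty.
    (P := fun r : R M => r = 0 ∨ ∃ x, r = mdist hY (f.ev x) (g.ev x)) ⟨0, .inl rfl⟩ (K := η) (by
      rintro _ (rfl | ⟨x, rfl⟩)
      exacts [hη, h x])
  refine ⟨t, ⟨(isUnifBound_iff hY).2 ⟨t, ht _ (.inl rfl), rfl, fun x => ht _ (.inr ⟨x, rfl⟩)⟩, ?_⟩,
    ht' _ ?_⟩
  · intro r hr
    obtain ⟨r, hr', rfl, h⟩ := (isUnifBound_iff hY).1 hr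
    refine ht' r ?_
    rintro _ (rfl | ⟨x, rfl⟩)
    exacts [hr', h x]
  · rintro _ (rfl | ⟨x, rfl⟩)
    exacts [hη, h x]

end Functions

/-! ### Countable sets -/

theorem isCountableSet_iff {S : M} :
    IsCountableSet S ↔ ∃ i : El S → N M, DFun i ∧ ∀ a b, i a = i b → a = b := by
  constructor
  · rintro ⟨f, hf, hinj⟩
    let f' : Mp (fun x => x ∈ᴹ S) fun x => IsNat x := ⟨f, hf⟩
    refine ⟨fun a => f'.ev a, inferInstance, fun a b hab => Subtype.ext ?_⟩
    refine hinj _ _ _ (f'.app_ev a) ?_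
    rw [show f'.ev a = f'.ev b from hab]
    exact f'.app_ev b
  · rintro ⟨i, hi, hinj⟩
    obtain ⟨f, hf⟩ := exists_map (A := fun x => x ∈ᴹ S) (B := fun x => IsNat x) i
    refine ⟨f.1, f.2, fun a a' b h h' => ?_⟩
    obtain ⟨ha, rfl⟩ := Mp.app_iff'.1 h
    obtain ⟨ha', h⟩ := Mp.app_iff'.1 h'
    rw [hf, hf] at h
    exact congrArg Subtype.val (hinj _ _ (Subtype.ext h))

/-- A definable choice of an element of a countable set. -/
theorem exists_choice_of_inj {i : Δ → N M} (hi : DFun i) (hinj : ∀ a b, i a = i b → a = b)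
    {P : Γ → Δ → Prop} (hP : Dfn fun p : Γ × Δ => P p.1 p.2) (h : ∀ v, ∃ a, P v a) :
    ∃ c : Γ → Δ, DFun c ∧ (∀ v, P v (c v)) ∧ ∀ v a, P v a → i (c v) ≤ i a := by
  have h1 := hi.clo₁
  have h2 := hP.clo₂
  have key : ∀ v, ∃ a, P v a ∧ ∀ b, P v b → i a ≤ i b := by
    intro v
    obtain ⟨a, ha⟩ := h v
    obtain ⟨n, ⟨b, hb, rfl⟩, hmin⟩ := N.exists_least (P := fun n => ∃ a, P v a ∧ i a = n)
      ⟨_, a, ha, rfl⟩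
    exact ⟨b, hb, fun c hc => hmin _ ⟨c, hc, rfl⟩⟩
  -- This choice takes place outside `M`, but it has no freedom: by injectivity of `i` the element
  -- of least index is unique, which makes the graph of `c` definable.
  choose c hc hmin using key
  refine ⟨c, DFun.of_graph (R := fun v a => P v a ∧ ∀ b, P v b → i a ≤ i b) inferInstance ?_, hc,
    hmin⟩
  intro v a
  constructor
  · rintro ⟨ha, hmin'⟩
    exact hinj _ _ (le_antisymm (hmin v a ha) (hmin' _ (hc v)))
  · rintro rfl
    exact ⟨hc v, hmin v⟩

/-! ### The Arzelà--Ascoli theorem -/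

theorem N.le_apply {k : N M → N M} (hk : DFun k) (hmono : ∀ i j, i < j → k i < k j) (n : N M) :
    n ≤ k n := by
  have := hk.clo₁
  refine N.ind (P := fun n : N M => n ≤ k n) (N.zero_le _) ?_ n
  exact fun n ih => N.succ_le (ih.trans_lt (hmono _ _ (N.lt_succ_self n)))

/-! ### Uniform limits; from convergent subsequences to countable subsets. -/

section Limits

variable {X dX Y dY : M}

/-- The three-term estimate through one approximating `f`, with the first two terms bounded together
by `η` and the third by `θ < η`. -/
theorem IsContBdd.of_uniform_limit (hX : IsMetric X dX) (hY : IsMetric Y dY)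
    {l : Mp (fun x => x ∈ᴹ X) fun y => y ∈ᴹ Y}
    (h : ∀ ε : R M, 0 < ε → ∃ f : Mp (fun x => x ∈ᴹ X) fun y => y ∈ᴹ Y,
      IsContBdd X dX Y dY f.1 ∧ ∀ x, mdist hY (f.ev x) (l.ev x) < ε) :
    IsContBdd X dX Y dY l.1 := by
  rw [isContBdd_iff hX hY]
  constructor
  · intro x ε hε
    obtain ⟨η, hη, -, hηε⟩ := exists_half hε
    obtain ⟨θ, hθ, hθη, hθη'⟩ := exists_half hη
    obtain ⟨f, hf, hfl⟩ := h θ hθ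
    obtain ⟨δ, hδ, hfδ⟩ := ((isContBdd_iff hX hY).1 hf).1 x θ hθ
    refine ⟨δ, hδ, fun x' hx' => ?_⟩
    refine mdist_lt_of_half hY (f.ev x') hηε ?_ ((hfl x').trans hθη).le
    refine (mdist_lt_of_half hY (f.ev x) hθη' ?_ (hfδ x' hx').le).le
    rw [mdist_comm]
    exact (hfl x).le
  · obtain ⟨f, hf, hfl⟩ := h (rho 0) (rho_pos 0)
    obtain ⟨K, hK⟩ := ((isContBdd_iff hX hY).1 hf).2
    refine ⟨radd (rho 0) (radd K (rho 0)), fun x x' => ?_⟩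
    refine (mdist_triangle hY _ (f.ev x) _).trans (radd_le_radd ?_
      ((mdist_triangle hY _ (f.ev x') _).trans (radd_le_radd (hK x x') (hfl x').le)))
    rw [mdist_comm]
    exact (hfl x).le

variable {F : M} (hF : ∀ f, f ∈ᴹ F → IsContBdd X dX Y dY f)

/-- The function given by an element of the family `F`. -/
def mp (f : El F) : Mp (fun x => x ∈ᴹ X) fun y => y ∈ᴹ Y := ⟨f.1, (hF f.1 f.2).1⟩

instance DFun.mp {f : Γ → El F} [DFun f] : DFun fun v => mp hF (f v) := by
  unfold SetModel.mp
  infer_instance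

theorem seqsHaveConvSubseq_iff_uniform (hY : IsMetric Y dY) :
    SeqsHaveConvSubseq (fun f => f ∈ᴹ F) (fun f => IsContBdd X dX Y dY f) (SupDist X dY) ↔
      ∀ s : N M → El F, DFun s → ∃ k : N M → N M, DFun k ∧ (∀ i j, i < j → k i < k j) ∧
        ∃ l : Mp (fun x => x ∈ᴹ X) fun y => y ∈ᴹ Y, IsContBdd X dX Y dY l.1 ∧
          ∀ ε : R M, 0 < ε → ∃ n₀, ∀ n, n₀ ≤ n →
            ∀ x, mdist hY ((mp hF (s (k n))).ev x) (l.ev x) < ε := by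
  rw [seqsHaveConvSubseq_iff]
  refine forall_congr' fun s => forall_congr' fun _ => exists_congr fun k =>
    and_congr_right fun _ => and_congr_right fun _ => ?_
  constructor
  · rintro ⟨l, hl, h⟩
    refine ⟨⟨l, hl.1⟩, hl, fun ε hε => ?_⟩
    obtain ⟨n₀, hn₀⟩ := h ε hε
    refine ⟨n₀, fun n hn => ?_⟩
    obtain ⟨r, hr, hrε⟩ := hn₀ n hn
    exact SupDist.mdist_le hY (f := mp hF (s (k n))) (g := ⟨l, hl.1⟩) hr hrε
  · rintro ⟨l, hl, h⟩
    refine ⟨l.1, hl, fun ε hε => ?_⟩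
    -- Strict pointwise bounds only give a weak bound on the supremum, so a smaller `η` is needed.
    obtain ⟨η, hη, hηε, -⟩ := exists_half hε
    obtain ⟨n₀, hn₀⟩ := h η hη
    refine ⟨n₀, fun n hn => ?_⟩
    obtain ⟨t, ht, htη⟩ := exists_supDist hY hη.le fun x => (hn₀ n hn x).le
    exact ⟨t.1, ht, R.lt_iff.1 (htη.trans_lt hηε)⟩

theorem isEquicontinuous_iff (hX : IsMetric X dX) (hY : IsMetric Y dY) {G : M} (hG : Sub G F) :
    IsEquicontinuous X dX dY G ↔ ∀ (x : El X) (ε : R M), 0 < ε → ∃ δ : R M, 0 < δ ∧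
      ∀ (g : El G) (x' : El X), mdist hX x x' < δ →
        mdist hY ((mp hF ⟨g.1, hG _ g.2⟩).ev x) ((mp hF ⟨g.1, hG _ g.2⟩).ev x') < ε := by
  constructor
  · intro h x ε hε
    obtain ⟨δ, hδ, h⟩ := h x.1 ε.1 x.2 (isPos_iff.2 ⟨ε, hε, rfl⟩)
    obtain ⟨δ, hδ', rfl⟩ := isPos_iff.1 hδ
    exact ⟨δ, hδ', fun g x' hx' => (distLt_iff hY).1
      (h g.1 x'.1 g.2 x'.2 ((distLt_iff hX).2 hx') _ _
        ((mp hF ⟨g.1, hG _ g.2⟩).app_ev x) ((mp hF ⟨g.1, hG _ g.2⟩).app_ev x'))⟩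
  · intro h x ε hx hε
    obtain ⟨ε, hε', rfl⟩ := isPos_iff.1 hε
    obtain ⟨δ, hδ, h⟩ := h ⟨x, hx⟩ ε hε'
    refine ⟨δ.1, isPos_iff.2 ⟨δ, hδ, rfl⟩, fun f x' hf hx' hd y y' hy hy' => ?_⟩
    obtain ⟨_, rfl⟩ := (Mp.app_iff' (f := mp hF ⟨f, hG _ hf⟩)).1 hy
    obtain ⟨_, rfl⟩ := (Mp.app_iff' (f := mp hF ⟨f, hG _ hf⟩)).1 hy'
    exact (distLt_iff hY).2 (h ⟨f, hf⟩ ⟨x', hx'⟩ ((distLt_iff hX).1 hd))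

/-- Countability of `G` allows a definable lift of a sequence of values at `x` to a sequence of
functions in `G`; evaluating the uniform limit of a subsequence at `x` finishes the argument. -/
theorem ptwiseRelSeqCompact_of_seqs (hF : ∀ f, f ∈ᴹ F → IsContBdd X dX Y dY f) (hY : IsMetric Y dY)
    (h : SeqsHaveConvSubseq (fun f => f ∈ᴹ F) (fun f => IsContBdd X dX Y dY f) (SupDist X dY))
    {G : M} (hG : Sub G F) (hc : IsCountableSet G) : PtwiseRelSeqCompact X Y dY G := by
  intro x hx
  obtain ⟨i, hi, hinj⟩ := isCountableSet_iff.1 hc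
  rw [seqsHaveConvSubseq_iff]
  intro s hs
  have := hs.clo₁
  obtain ⟨c, hc, hcs, -⟩ := exists_choice_of_inj (P := fun (n : N M) (g : El G) => App g.1 x (s n).1)
    hi hinj inferInstance (fun n => by
      obtain ⟨f, hf, h⟩ := (s n).2
      exact ⟨⟨f, hf⟩, h⟩)
  have := hc.clo₁
  obtain ⟨k, hk, hmono, l, hl, hlim⟩ := (seqsHaveConvSubseq_iff_uniform hF hY).1 h
    (fun n => ⟨(c n).1, hG _ (c n).2⟩) inferInstance
  refine ⟨k, hk, hmono, (l.ev ⟨x, hx⟩).1, (l.ev ⟨x, hx⟩).2, fun ε hε => ?_⟩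
  obtain ⟨n₀, hn₀⟩ := hlim ε hε
  refine ⟨n₀, fun n hn => ⟨_, ?_, R.lt_iff.1 (hn₀ n hn ⟨x, hx⟩)⟩⟩
  have e : (s (k n)).1 = ((mp hF ⟨(c (k n)).1, hG _ (c (k n)).2⟩).ev ⟨x, hx⟩).1 :=
    Mp.app_iff.1 (hcs (k n))
  rw [e]
  exact dist_mdist hY _ _

theorem isEquicontinuous_of_seqs (hF : ∀ f, f ∈ᴹ F → IsContBdd X dX Y dY f)
    (hX : IsMetric X dX) (hY : IsMetric Y dY)
    (h : SeqsHaveConvSubseq (fun f => f ∈ᴹ F) (fun f => IsContBdd X dX Y dY f) (SupDist X dY))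
    {G : M} (hG : Sub G F) (hc : IsCountableSet G) : IsEquicontinuous X dX dY G := by
  obtain ⟨i, hi, hinj⟩ := isCountableSet_iff.1 hc
  rw [isEquicontinuous_iff hF hX hY hG]
  intro x ε hε
  by_contra hcon
  push Not at hcon
  -- Only the function is selected. The point `x'` stays under the existential quantifier, because
  -- `X` offers no way of selecting it definably.
  obtain ⟨c, hc, hcs, -⟩ := exists_choice_of_inj (P := fun (n : N M) (g : El G) =>
      ∃ x', mdist hX x x' < rho n ∧
        ε ≤ mdist hY ((mp hF ⟨g.1, hG _ g.2⟩).ev x) ((mp hF ⟨g.1, hG _ g.2⟩).ev x'))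
    hi hinj inferInstance fun n => hcon (rho n) (rho_pos n)
  have := hc.clo₁
  obtain ⟨k, hk, hmono, l, hl, hlim⟩ := (seqsHaveConvSubseq_iff_uniform hF hY).1 h
    (fun n => ⟨(c n).1, hG _ (c n).2⟩) inferInstance
  obtain ⟨η, hη, -, hηε⟩ := exists_half hε
  obtain ⟨θ, hθ, hθη, hθη'⟩ := exists_half hη
  obtain ⟨δ, hδ, hlδ⟩ := ((isContBdd_iff hX hY).1 hl).1 x θ hθ
  obtain ⟨n₀, hn₀⟩ := hlim θ hθ
  obtain ⟨n₁, hn₁⟩ := exists_rho_lt hδ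
  -- At this index the function is within `θ` of `l`, and since `k n` is at least `n` the point `x'`
  -- is within `δ` of `x`.
  obtain ⟨x', hx', hfx⟩ := hcs (k (max n₀ n₁))
  have hf := hn₀ (max n₀ n₁) (le_max_left _ _)
  refine hfx.not_gt (mdist_lt_of_half hY (l.ev x') hηε
    (mdist_lt_of_half hY (l.ev x) hθη' (hf x).le (hlδ x' (hx'.trans ?_)).le).le ?_)
  · exact (rho_anti ((le_max_right _ _).trans (N.le_apply hk hmono _))).trans_lt hn₁
  · rw [mdist_comm]
    exact ((hf x').trans hθη).le

end Limits

/-! ### Uniformly convergent subsequences -/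

section Cauchy

variable {X dX Y dY : M}

/-- The set `A` contains arbitrarily large natural numbers. -/
def Unb (A : M) : Prop := ∀ n : N M, ∃ m : N M, n ≤ m ∧ m.1 ∈ᴹ A

instance Dfn.unb {A : Γ → M} [DFun A] : Dfn fun v => Unb (A v) := by
  have := DFun.clo₁ ‹DFun A›
  unfold Unb
  infer_instance

/-- Every subsequence of the sequence `φ` has a subsequence that converges at the point `x`. -/
def PtwiseCompact (hY : IsMetric Y dY) (φ : N M → El X → El Y) : Prop :=
  ∀ (x : El X) (b : N M → N M), DFun b → ∃ k : N M → N M, DFun k ∧ (∀ i j, i < j → k i < k j) ∧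
    ∃ y : El Y, ∀ ε : R M, 0 < ε → ∃ n₀, ∀ n, n₀ ≤ n → mdist hY (φ (b (k n)) x) y < ε

/-- The sequence `φ` is equicontinuous. -/
def EquiCont (hX : IsMetric X dX) (hY : IsMetric Y dY) (φ : N M → El X → El Y) : Prop :=
  ∀ (x : El X) (ε : R M), 0 < ε → ∃ δ : R M, 0 < δ ∧ ∀ (n : N M) (x' : El X),
    mdist hX x x' < δ → mdist hY (φ n x) (φ n x') < ε

variable {hX : IsMetric X dX} {hY : IsMetric Y dY} {φ : N M → El X → El Y}

/-- Convergence along a subsequence at one point `x₀` of `U` brings the values at `x₀` within `θ` of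
each other; small oscillation on `U` carries this over to every other point of `U`. -/
theorem exists_unb_of_osc (hp : PtwiseCompact hY φ) {ε θ η : R M}
    (hη : radd η η < ε) (hθ : 0 < θ) (hθη : θ < η) (hθη' : radd θ θ < η) {U B : M}
    (hU : ∀ (n : N M) (x y : El X), x.1 ∈ᴹ U → y.1 ∈ᴹ U → mdist hY (φ n x) (φ n y) < θ)
    (hB : Unb B) : ∃ B', Sub B' B ∧ Unb B' ∧ ∀ a b : N M, a.1 ∈ᴹ B' → b.1 ∈ᴹ B' →
      ∀ x : El X, x.1 ∈ᴹ U → mdist hY (φ a x) (φ b x) < ε := by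
  by_cases hne : ∃ x : El X, x.1 ∈ᴹ U
  · obtain ⟨x₀, hx₀⟩ := hne
    -- `b n` is the least element of `B` that is at least `n`; repetitions do no harm.
    obtain ⟨b, hb, hbB, -⟩ := exists_choice_of_inj (i := fun n : N M => n)
      (P := fun n m : N M => n ≤ m ∧ m.1 ∈ᴹ B) inferInstance (fun _ _ h => h) inferInstance hB
    obtain ⟨k, hk, hmono, y, hy⟩ := hp x₀ b hb
    obtain ⟨ζ, hζ, -, hζθ⟩ := exists_half hθ
    obtain ⟨n₀, hn₀⟩ := hy ζ hζ
    have h1 := hb.clo₁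
    have h2 := hk.clo₁
    refine ⟨sep B fun z => ∃ n, n₀ ≤ n ∧ z = (b (k n)).1, fun z hz => (mem_sep.1 hz).1, ?_, ?_⟩
    · intro n
      refine ⟨b (k (max n n₀)), ?_, mem_sep.2 ⟨(hbB _).2, _, le_max_right _ _, rfl⟩⟩
      exact ((le_max_left _ _).trans (N.le_apply hk hmono _)).trans (hbB _).1
    · intro a c ha hc x hx
      obtain ⟨-, i, hi, ha⟩ := mem_sep.1 ha
      obtain ⟨-, j, hj, hc⟩ := mem_sep.1 hc
      obtain rfl := Subtype.ext ha
      obtain rfl := Subtype.ext hc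
      refine mdist_lt_of_half hY (φ (b (k j)) x₀) hη ?_ ((hU _ _ _ hx₀ hx).trans hθη).le
      refine (mdist_lt_of_half hY (φ (b (k i)) x₀) hθη' (hU _ _ _ hx hx₀).le ?_).le
      refine (mdist_lt_of_half hY y hζθ (hn₀ i hi).le ?_).le
      rw [mdist_comm]
      exact (hn₀ j hj).le
  · exact ⟨B, fun _ h => h, hB, fun _ _ _ _ x hx => (hne ⟨x, hx⟩).elim⟩

/-- The cover is the set of all open sets on which every term oscillates by less than `θ`, so no
radius has to be chosen for each point. -/
theorem exists_finite_cover (hφ : DFun fun p : N M × El X => φ p.1 p.2)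
    (hXc : IsCompactSpace X dX) (he : EquiCont hX hY φ) {θ : R M} (hθ : 0 < θ) :
    ∃ C, IsFiniteSet C ∧ (∀ x : El X, ∃ U, U ∈ᴹ C ∧ x.1 ∈ᴹ U) ∧
      ∀ U, U ∈ᴹ C → ∀ (n : N M) (x y : El X), x.1 ∈ᴹ U → y.1 ∈ᴹ U →
        mdist hY (φ n x) (φ n y) < θ := by
  have h1 := hφ.clo₂
  obtain ⟨C, hC⟩ : ∃ C : M, ∀ U, U ∈ᴹ C ↔ U ∈ᴹ pow X ∧
      ((∀ x : El X, x.1 ∈ᴹ U → ∃ r : R M, 0 < r ∧ ∀ y : El X, mdist hX x y < r → y.1 ∈ᴹ U) ∧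
        ∀ (n : N M) (x y : El X), x.1 ∈ᴹ U → y.1 ∈ᴹ U → mdist hY (φ n x) (φ n y) < θ) :=
    ⟨sep (pow X) _, fun U => mem_sep⟩
  have hopen : ∀ U, U ∈ᴹ C → IsOpenIn X dX U := by
    intro U hU
    obtain ⟨h, hopen, -⟩ := (hC U).1 hU
    have hUX := mem_pow.1 h
    refine ⟨hUX, fun x hx => ?_⟩
    obtain ⟨r, hr, h⟩ := hopen ⟨x, hUX x hx⟩ hx
    exact ⟨r.1, isPos_iff.2 ⟨r, hr, rfl⟩, fun y hy hd =>
      h ⟨y, hy⟩ ((distLt_iff hX (x := ⟨x, hUX x hx⟩) (y := ⟨y, hy⟩)).1 hd)⟩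
  have hcover : ∀ x, x ∈ᴹ X → ∃ U, U ∈ᴹ C ∧ x ∈ᴹ U := by
    intro x hx
    obtain ⟨η, hη, -, hηθ⟩ := exists_half hθ
    obtain ⟨δ, hδ, h⟩ := he ⟨x, hx⟩ η hη
    -- `U` is the interior of the ball of radius `δ`. Its openness follows from halving radii and
    -- needs no subtraction of real numbers.
    obtain ⟨U, hU⟩ : ∃ U : M, ∀ z, z ∈ᴹ U ↔ z ∈ᴹ X ∧ ∃ y : El X, y.1 = z ∧ ∃ r : R M, 0 < r ∧
        ∀ w : El X, mdist hX y w < r → mdist hX ⟨x, hx⟩ w < δ := ⟨sep X _, fun z => mem_sep⟩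
    have hU' : ∀ y : El X, y.1 ∈ᴹ U ↔ ∃ r : R M, 0 < r ∧
        ∀ w : El X, mdist hX y w < r → mdist hX ⟨x, hx⟩ w < δ := by
      intro y
      rw [hU]
      constructor
      · rintro ⟨-, y', hy', h⟩
        rwa [Subtype.ext hy'] at h
      · exact fun h => ⟨y.2, y, rfl, h⟩
    have hball : ∀ y : El X, y.1 ∈ᴹ U → mdist hX ⟨x, hx⟩ y < δ := by
      intro y hy
      obtain ⟨r, hr, h⟩ := (hU' y).1 hy
      exact h y (by rwa [mdist_self])
    refine ⟨U, (hC U).2 ⟨mem_pow.2 fun z hz => ((hU z).1 hz).1, ?_, ?_⟩,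
      (hU' ⟨x, hx⟩).2 ⟨δ, hδ, fun w hw => hw⟩⟩
    · intro y hy
      obtain ⟨r, hr, h⟩ := (hU' y).1 hy
      obtain ⟨t, ht, -, htr⟩ := exists_half hr
      exact ⟨t, ht, fun z hz => (hU' z).2 ⟨t, ht, fun w hw =>
        h w (mdist_lt_of_half hX z htr hz.le hw.le)⟩⟩
    · intro n y z hy hz
      refine mdist_lt_of_half hY (φ n ⟨x, hx⟩) hηθ ?_ (h n z (hball z hz)).le
      rw [mdist_comm]
      exact (h n y (hball y hy)).le
  obtain ⟨C', hC', hfin, hcov⟩ := hXc C hopen hcover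
  exact ⟨C', hfin, fun x => hcov x.1 x.2, fun U hU => ((hC U).1 (hC' U hU)).2.2⟩

theorem exists_unb_of_compact (hφ : DFun fun p : N M × El X => φ p.1 p.2)
    (hXc : IsCompactSpace X dX) (hp : PtwiseCompact hY φ) (he : EquiCont hX hY φ) {ε : R M}
    (hε : 0 < ε) {A : M} (hA : Unb A) : ∃ B, Sub B A ∧ Unb B ∧ ∀ a b : N M, a.1 ∈ᴹ B → b.1 ∈ᴹ B →
      ∀ x : El X, mdist hY (φ a x) (φ b x) < ε := by
  have h1 := hφ.clo₂
  obtain ⟨η, hη, -, hηε⟩ := exists_half hε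
  obtain ⟨θ, hθ, hθη, hθη'⟩ := exists_half hη
  obtain ⟨C, ⟨r, f, hr, hf, -, hsurj⟩, hcov, hosc⟩ := exists_finite_cover hφ hXc he hθ
  -- The induction runs over an enumeration `f` of the finite cover and asserts only that some `B`
  -- exists, so the successive thinnings need no choice.
  have key : ∀ i : N M, ∃ B, Sub B A ∧ Unb B ∧ ∀ j : N M, j < i → ∀ U, App f j.1 U →
      ∀ a b : N M, a.1 ∈ᴹ B → b.1 ∈ᴹ B → ∀ x : El X, x.1 ∈ᴹ U →
        mdist hY (φ a x) (φ b x) < ε := by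
    intro i
    refine N.ind (P := fun i : N M => ∃ B, Sub B A ∧ Unb B ∧ ∀ j : N M, j < i → ∀ U, App f j.1 U →
      ∀ a b : N M, a.1 ∈ᴹ B → b.1 ∈ᴹ B → ∀ x : El X, x.1 ∈ᴹ U →
        mdist hY (φ a x) (φ b x) < ε) ?_ ?_ i
    · exact ⟨A, fun _ h => h, hA, fun j hj => (N.not_lt_zero j hj).elim⟩
    · rintro i ⟨B, hBA, hB, h⟩
      by_cases hi : ∃ U, App f i.1 U
      · obtain ⟨U, hU⟩ := hi
        obtain ⟨B', hB'B, hB', h'⟩ := exists_unb_of_osc hp hηε hθ hθη hθη'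
          (hosc U (hf.cod hU)) hB
        refine ⟨B', fun z hz => hBA z (hB'B z hz), hB', fun j hj V hV a b ha hb => ?_⟩
        rcases (N.lt_succ.1 hj).lt_or_eq with hj | rfl
        · exact h j hj V hV a b (hB'B _ ha) (hB'B _ hb)
        · rw [(hf.2 _ (hf.dom hV)).unique hV hU]
          exact h' a b ha hb
      -- Past the end of the enumeration nothing has to be thinned out.
      · refine ⟨B, hBA, hB, fun j hj V hV => ?_⟩
        rcases (N.lt_succ.1 hj).lt_or_eq with hj | rfl
        · exact h j hj V hV
        · exact (hi ⟨V, hV⟩).elim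
  obtain ⟨B, hBA, hB, h⟩ := key ⟨r, hr⟩
  refine ⟨B, hBA, hB, fun a b ha hb x => ?_⟩
  obtain ⟨U, hU, hx⟩ := hcov x
  obtain ⟨i, hi⟩ := hsurj U hU
  have hir : i ∈ᴹ r := hf.dom hi
  exact h ⟨i, N.isNat_of_mem (n := ⟨r, hr⟩) hir⟩ hir U hi a b ha hb x hx

/-- Each stage selects one natural number, never a set: the least `m` in the current set for which
the later indices with terms close to the `m`-th one are still unbounded. Those indices form the
next set. -/
theorem exists_cauchy_subseq (hφ : DFun fun p : N M × El X => φ p.1 p.2)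
    (hXc : IsCompactSpace X dX) (hp : PtwiseCompact hY φ) (he : EquiCont hX hY φ) :
    ∃ m : N M → N M, DFun m ∧ (∀ i j, i < j → m i < m j) ∧
      ∀ i j, i < j → ∀ x, mdist hY (φ (m i) x) (φ (m j) x) < rho i := by
  have h1 := hφ.clo₂
  obtain ⟨nxt, hnxt, hnxt'⟩ : ∃ nxt : N M × M × N M → M, DFun nxt ∧ ∀ (j : N M) (A : M) (m n : N M),
      n.1 ∈ᴹ nxt (j, A, m) ↔
        n.1 ∈ᴹ A ∧ m < n ∧ ∀ x, mdist hY (φ m x) (φ n x) < rho j := by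
    refine ⟨fun p => sep p.2.1 fun z => ∃ n : N M, n.1 = z ∧ p.2.2 < n ∧
      ∀ x, mdist hY (φ p.2.2 x) (φ n x) < rho p.1, inferInstance, fun j A m n => ?_⟩
    refine mem_sep.trans (and_congr_right fun _ => ?_)
    constructor
    · rintro ⟨n', hn', h⟩
      rwa [Subtype.ext hn'] at h
    · exact fun h => ⟨n, rfl, h⟩
  have h2 := hnxt.clo₁
  obtain ⟨c, hc, hcA, -⟩ := exists_choice_of_inj (i := fun n : N M => n)
    -- The premise makes `c` total; its value on a set that is not unbounded is irrelevant.
    (P := fun (v : N M × M) (m : N M) => Unb v.2 → m.1 ∈ᴹ v.2 ∧ Unb (nxt (v.1, v.2, m)))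
    inferInstance (fun _ _ h => h) inferInstance (by
      rintro ⟨j, A⟩
      by_cases hA : Unb A
      · obtain ⟨B, hBA, hB, h⟩ := exists_unb_of_compact hφ hXc hp he (rho_pos j) hA
        -- Any `m` in `B` is suitable, since the next set then contains all later elements of `B`.
        obtain ⟨m, -, hm⟩ := hB 0
        refine ⟨m, fun _ => ⟨hBA _ hm, fun n => ?_⟩⟩
        obtain ⟨k, hk, hkB⟩ := hB (max n (m + 1))
        exact ⟨k, (le_max_left _ _).trans hk, (hnxt' _ _ _ _).2 ⟨hBA _ hkB,
          N.add_one_le_iff.1 ((le_max_right _ _).trans hk), h m k hm hkB⟩⟩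
      · exact ⟨0, fun h => (hA h).elim⟩)
  have h3 := hc.clo₁
  obtain ⟨S, hS, hS0, hS1⟩ : ∃ S : N M → M, DFun S ∧ S 0 = omega M ∧
      ∀ j, S j.succ = nxt (j, S j, c (j, S j)) := by
    refine ⟨fun j => natRec (omega M) (fun j A => nxt (j, A, c (j, A))) j, inferInstance, ?_, ?_⟩
    · exact natRec_zero
    · exact fun j => natRec_succ j
  have h4 := hS.clo₁
  have hunb : ∀ j, Unb (S j) := by
    refine N.ind ?_ ?_
    · rw [hS0]
      exact fun n => ⟨n, le_rfl, mem_omega.2 n.2⟩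
    · intro j ih
      rw [hS1]
      exact (hcA (j, S j) ih).2
  have hmem : ∀ j, (c (j, S j)).1 ∈ᴹ S j := fun j => (hcA (j, S j) (hunb j)).1
  -- The sets `S j` decrease, so what stage `i` guarantees survives in all later sets.
  have hlater : ∀ j i : N M, i < j → ∀ n : N M, n.1 ∈ᴹ S j →
      c (i, S i) < n ∧ ∀ x, mdist hY (φ (c (i, S i)) x) (φ n x) < rho i := by
    refine N.ind (P := fun j => ∀ i : N M, i < j → ∀ n : N M, n.1 ∈ᴹ S j →
      c (i, S i) < n ∧ ∀ x, mdist hY (φ (c (i, S i)) x) (φ n x) < rho i) ?_ ?_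
    · exact fun i hi => (N.not_lt_zero i hi).elim
    · intro j ih i hi n hn
      rw [hS1, hnxt'] at hn
      rcases (N.lt_succ.1 hi).lt_or_eq with hi | rfl
      exacts [ih i hi n hn.1, hn.2]
  exact ⟨fun j => c (j, S j), inferInstance, fun i j hij => (hlater j i hij _ (hmem j)).1,
    fun i j hij => (hlater j i hij _ (hmem j)).2⟩

theorem exists_uniform_limit (hφ : DFun fun p : N M × El X => φ p.1 p.2)
    (hXc : IsCompactSpace X dX) (hp : PtwiseCompact hY φ) (he : EquiCont hX hY φ) :
    ∃ m : N M → N M, DFun m ∧ (∀ i j, i < j → m i < m j) ∧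
      ∃ l : Mp (fun x => x ∈ᴹ X) fun y => y ∈ᴹ Y, ∀ ε : R M, 0 < ε → ∃ n₀, ∀ n, n₀ ≤ n →
        ∀ x, mdist hY (φ (m n) x) (l.ev x) < ε := by
  obtain ⟨m, hm, hmono, hC⟩ := exists_cauchy_subseq hφ hXc hp he
  -- At each `x` some subsequence converges, and the Cauchy estimate extends this to the whole
  -- sequence at a rate independent of `x`.
  have key : ∀ x, ∃ y, ∀ (j : N M) (ε η : R M), 0 < η → radd η η < ε → rho j ≤ η →
      mdist hY (φ (m j) x) y < ε := by
    intro x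
    obtain ⟨k, hk, hkmono, y, hy⟩ := hp x m hm
    refine ⟨y, fun j ε η hη hηε hj => ?_⟩
    obtain ⟨n₀, hn₀⟩ := hy η hη
    have hlt : j < k (max n₀ (j + 1)) := N.add_one_le_iff.1
      ((le_max_right _ _).trans (N.le_apply hk hkmono _))
    exact mdist_lt_of_half hY (φ (m (k (max n₀ (j + 1)))) x) hηε ((hC _ _ hlt x).le.trans hj)
      (hn₀ _ (le_max_left _ _)).le
  choose l hl using key
  have hlim : ∀ ε : R M, 0 < ε → ∃ n₀, ∀ n, n₀ ≤ n → ∀ x, mdist hY (φ (m n) x) (l x) < ε := by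
    intro ε hε
    obtain ⟨η, hη, -, hηε⟩ := exists_half hε
    obtain ⟨n₀, hn₀⟩ := exists_rho_lt hη
    exact ⟨n₀, fun n hn x => hl x n ε η hη hηε ((rho_anti hn).trans hn₀.le)⟩
  have h1 := hφ.clo₂
  have h2 := hm.clo₁
  -- The values of `l` were picked outside `M`. They are the unique limits of the sequences `φ (m n)
  -- x`, which defines `l` inside `M`.
  have hdl : DFun l := by
    refine DFun.of_graph (R := fun x y => ∀ ε : R M, 0 < ε → ∃ n₀, ∀ n, n₀ ≤ n →
      mdist hY (φ (m n) x) y < ε) inferInstance ?_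
    intro x y
    constructor
    · intro h
      refine mdist_eq_of_forall hY fun ε hε => ?_
      obtain ⟨η, hη, -, hηε⟩ := exists_half hε
      obtain ⟨n₀, hn₀⟩ := h η hη
      obtain ⟨n₁, hn₁⟩ := hlim η hη
      refine mdist_lt_of_half hY (φ (m (max n₀ n₁)) x) hηε ?_ (hn₀ _ (le_max_left _ _)).le
      rw [mdist_comm]
      exact (hn₁ _ (le_max_right _ _) x).le
    · rintro rfl ε hε
      obtain ⟨n₀, hn₀⟩ := hlim ε hε
      exact ⟨n₀, fun n hn => hn₀ n hn x⟩
  obtain ⟨l', hl'⟩ := exists_map (A := fun x => x ∈ᴹ X) (B := fun y => y ∈ᴹ Y) l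
  refine ⟨m, hm, hmono, l', ?_⟩
  simpa only [hl'] using hlim

end Cauchy

/-- The hypothesis is applied to the range of the given sequence only. -/
theorem seqs_of_countable {X dX Y dY F : M} (hX : IsMetric X dX) (hXc : IsCompactSpace X dX)
    (hY : IsMetric Y dY) (hF : ∀ f, f ∈ᴹ F → IsContBdd X dX Y dY f)
    (h : ∀ G, Sub G F → IsCountableSet G →
      PtwiseRelSeqCompact X Y dY G ∧ IsEquicontinuous X dX dY G) :
    SeqsHaveConvSubseq (fun f => f ∈ᴹ F) (fun f => IsContBdd X dX Y dY f) (SupDist X dY) := by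
  rw [seqsHaveConvSubseq_iff_uniform hF hY]
  intro s hs
  have h1 := hs.clo₁
  obtain ⟨G, hG⟩ : ∃ G : M, ∀ f, f ∈ᴹ G ↔ f ∈ᴹ F ∧ ∃ n, (s n).1 = f :=
    ⟨sep F _, fun f => mem_sep⟩
  have hGF : Sub G F := fun f hf => ((hG f).1 hf).1
  have hsG : ∀ n, (s n).1 ∈ᴹ G := fun n => (hG _).2 ⟨(s n).2, n, rfl⟩
  have hcount : IsCountableSet G := by
    -- Sending a function to the least index at which it occurs injects the range into `N M`.
    obtain ⟨c, hc, hcs, -⟩ := exists_choice_of_inj (i := fun n : N M => n)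
      (P := fun (g : El G) n => (s n).1 = g.1) inferInstance (fun _ _ h => h) inferInstance
      fun g => ((hG g.1).1 g.2).2
    refine isCountableSet_iff.2 ⟨c, hc, fun a b hab => Subtype.ext ?_⟩
    rw [← hcs a, ← hcs b, hab]
  obtain ⟨hp, he⟩ := h G hGF hcount
  rw [isEquicontinuous_iff hF hX hY hGF] at he
  have hp' : PtwiseCompact hY fun n x => (mp hF (s n)).ev x := by
    intro x b hb
    have h2 := hb.clo₁
    obtain ⟨k, hk, hkmono, y, hy, hlim⟩ := seqsHaveConvSubseq_iff.1 (hp x.1 x.2)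
      (fun n => ⟨((mp hF (s (b n))).ev x).1, (s (b n)).1, hsG _, (mp hF (s (b n))).app_ev x⟩)
      inferInstance
    refine ⟨k, hk, hkmono, ⟨y, hy⟩, fun ε hε => ?_⟩
    obtain ⟨n₀, hn₀⟩ := hlim ε hε
    refine ⟨n₀, fun n hn => ?_⟩
    obtain ⟨r, hr, hrε⟩ := hn₀ n hn
    obtain rfl := (dist_iff hY (y := ⟨y, hy⟩)).1 hr
    exact R.lt_iff.2 hrε
  have he' : EquiCont hX hY fun n x => (mp hF (s n)).ev x := by
    intro x ε hε
    obtain ⟨δ, hδ, h⟩ := he x ε hε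
    exact ⟨δ, hδ, fun n x' hx' => h ⟨(s n).1, hsG n⟩ x' hx'⟩
  obtain ⟨m, hm, hmono, l, hl⟩ := exists_uniform_limit inferInstance hXc hp' he'
  refine ⟨m, hm, hmono, l, ?_, hl⟩
  refine IsContBdd.of_uniform_limit hX hY fun ε hε => ?_
  obtain ⟨n₀, hn₀⟩ := hl ε hε
  exact ⟨mp hF (s (m n₀)), hF _ (s (m n₀)).2, hn₀ n₀ le_rfl⟩

end SetModel

theorem mainTheorem8 {M : Type*} [SetModel.setLang.Structure M] (hM : SetModel.IsModelZF M)
    (X dX Y dY F : M)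
    (hX : SetModel.IsMetric X dX) (hXc : SetModel.IsCompactSpace X dX)
    (hXs : SetModel.IsSeparableSpace X dX) (hY : SetModel.IsMetric Y dY)
    (hF : ∀ f, SetModel.Mem f F → SetModel.IsContBdd X dX Y dY f) :
    SetModel.SeqsHaveConvSubseq (fun f => SetModel.Mem f F)
        (fun f => SetModel.IsContBdd X dX Y dY f) (SetModel.SupDist X dY) ↔
      ∀ G, SetModel.Sub G F → SetModel.IsCountableSet G →
        SetModel.PtwiseRelSeqCompact X Y dY G ∧ SetModel.IsEquicontinuous X dX dY G := by
  have : Fact (SetModel.IsModelZF M) := ⟨hM⟩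
  constructor
  · exact fun h G hG hc => ⟨SetModel.ptwiseRelSeqCompact_of_seqs hF hY h hG hc,
      SetModel.isEquicontinuous_of_seqs hF hX hY h hG hc⟩
  · exact SetModel.seqs_of_countable hX hXc hY hF
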